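/- **Markov incremental mirror descent.** Let $\|\cdot\|$ be a norm on $\mathbb R^d$ with dual norm $\|\cdot\|_*$, let $\mathcal X\subset\mathbb R^d$ be compact and convex, and let $\psi$ be convex and differentiable on $\mathcal X$ and $1$-strongly convex with respect to $\|\cdot\|$, i.e. $\psi(y)\ge\psi(x)+\langle\nabla\psi(x),y-x\rangle+\tfrac12\|x-y\|^2$ for $x,y\in\mathcal X$. Put $D(x,y)=\psi(x)-\psi(y)-\langle\nabla\psi(y),x-y\rangle$ and let $R>0$ satisfy $D(x,y)\le\tfrac12R^2$ for all $x,y\in\mathcal X$. Let $n\ge2$, let $\Pi_1,\dots,\Pi_n$ be probability distributions on a measurable space $\Xi$, let $F:\mathcal X\times\Xi\to\mathbb R$ be measurable, with $F(\cdot;\xi)$ convex for every $\xi$ and $F(x;\cdot)$ $\Pi_i$-integrable for every $x\in\mathcal X$ and every $i$, and let $\mathsf G(x;\xi)\in\partial F(x;\xi)$ be a fixed measurable selection of subgradients. Put $f_i(x)=\mathbb E_{\Pi_i}[F(x;\xi)]$ and $f(x)=\frac1n\sum_{i=1}^nf_i(x)$. Let $P\in\mathbb R^{n\times n}$ be doubly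 stochastic with second largest singular value $\sigma_2(P)<1$. A token $i(1),i(2),\dots\in\{1,\dots,n\}$, with $i(1)$ of arbitrary law, moves as a Markov chain with transition matrix $P$; at each time $t\ge1$, given the past tokens and samples and $i(t)$, a sample $\xi_t$ is drawn from $\Pi_{i(t)}$, and then $i(t+1)=j$ with probability $P_{i(t)j}$, given all tokens and samples up to time $t$. Fix $T\ge1$ and $L>0$, set $$\tau_{\rm mix}=\frac{\log(Tn)}{1-\sigma_2(P)},\qquad \alpha=\frac{R}{L\sqrt{\tau_{\rm mix}}},\qquad \alpha(t)=\frac{\alpha}{\sqrt t},$$ and, starting from an arbitrary fixed $x(1)\in\mathcal X$, let $$g(t)=\mathsf G(x(t);\xi_t),\qquad x(t+1)=\operatorname*{argmin}_{x\in\mathcal X}\Big\{\langle g(t),x\rangle+\frac1{\alpha(t)}D(x,x(t))\Big\}\quad(t\ge1).$$ Let $\widehat x(T)=\frac1T\sum_{t=1}^Tx(t)$ and let $x^\star\in\mathcal X$ be arbitrary. (a) If $\mathbb E_{\Pi_i}[\|\mathsf G(x;\xi)\|_*^2]\le L^2$ for every $i$ and every $x\in\mathcal X$, then $$\mathbb E[f(\widehat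 x(T))]-f(x^\star)\le\frac{5RL}{2}\cdot\frac{\sqrt{\tau_{\rm mix}}}{\sqrt T}+\frac{5RL}{\sqrt T}+\frac{RL}{T}\,\tau_{\rm mix}.$$ (b) Let $\delta\in(0,1)$ and $\tau_{\rm mix}\le T/2$. If for every $i$ and every $x\in\mathcal X$ we have $\|\mathsf G(x;\xi)\|_*\le L$ for $\Pi_i$-almost every $\xi$, then with probability at least $1-\delta$ $$f(\widehat x(T))-f(x^\star)\le\frac{5RL}{2}\cdot\frac{\sqrt{\tau_{\rm mix}}}{\sqrt T}+\frac{2RL}{\sqrt T}+\frac{RL}{T}\,\tau_{\rm mix}+\frac{3RL}{\sqrt T}\sqrt{\tau_{\rm mix}\log\frac{\tau_{\rm mix}}{\delta}}.$$ -/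

import Mathlib

open MeasureTheory

noncomputable section

/-- The second largest singular value of a square real matrix, acting on Euclidean space
(singular values are listed in non-increasing order, starting from index `0`). -/
def secondSingularValue {n : ℕ} (P : Matrix (Fin n) (Fin n) ℝ) : ℝ :=
  (Matrix.toEuclideanLin P).singularValues 1

/-- The mixing time bound `log (T n) / (1 - σ₂(P))`. -/
def tauMix {n : ℕ} (P : Matrix (Fin n) (Fin n) ℝ) (T : ℕ) : ℝ :=
  Real.log ((T : ℝ) * (n : ℝ)) / (1 - secondSingularValue P)

/-- The Bregman divergence `ψ(x) - ψ(y) - ⟨∇ψ(y), x - y⟩` of a prox-function `ψ` that is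
differentiable on `X`.  For convex `X` and `x, y ∈ X` the last term is the one-sided directional
derivative of `ψ` at `y` towards `x`, so it does not depend on how the derivative is
represented when `X` is lower dimensional. -/
def bregman {E : Type*} [NormedAddCommGroup E] [NormedSpace ℝ E]
    (ψ : E → ℝ) (X : Set E) (x y : E) : ℝ :=
  ψ x - ψ y - fderivWithin ℝ ψ X y (x - y)

/-- The subdifferential at `x` of a function on `X`; dual vectors are continuous linear
functionals, whose operator norm is the dual norm. -/
def subdifferentialOn {E : Type*} [NormedAddCommGroup E] [NormedSpace ℝ E]
    (X : Set E) (h : E → ℝ) (x : E) : Set (StrongDual ℝ E) :=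
  {g | ∀ y ∈ X, h x + g (y - x) ≤ h y}

/-- The conditions on the constraint set `X`, the prox-function `ψ` and the radius `R`:
`X` is compact and convex, `ψ` is convex, differentiable and `1`-strongly convex on `X` with
respect to the norm, and its Bregman divergence is at most `R ^ 2 / 2` on `X`. -/
structure IsProxSetup {E : Type*} [NormedAddCommGroup E] [NormedSpace ℝ E]
    (X : Set E) (ψ : E → ℝ) (R : ℝ) : Prop where
  isCompact : IsCompact X
  convex : Convex ℝ X
  convexOn : ConvexOn ℝ X ψ
  differentiableOn : DifferentiableOn ℝ ψ X
  stronglyConvex : ∀ x ∈ X, ∀ y ∈ X,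
    ψ x + fderivWithin ℝ ψ X x (y - x) + (1 / 2) * ‖x - y‖ ^ 2 ≤ ψ y
  bregman_le : ∀ x ∈ X, ∀ y ∈ X, bregman ψ X x y ≤ (1 / 2) * R ^ 2

/-- The conditions on the instantaneous losses `F(x; ξ)`, the local distributions `Q i` and the
fixed measurable subgradient selection `G(x; ξ)`. -/
structure IsLossFamily {E : Type*} [NormedAddCommGroup E] [NormedSpace ℝ E] [MeasurableSpace E]
    {Ξ : Type*} [MeasurableSpace Ξ] {n : ℕ}
    (X : Set E) (Q : Fin n → Measure Ξ) (F : E → Ξ → ℝ) (G : E → Ξ → StrongDual ℝ E) :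
    Prop where
  measurable_loss : Measurable (Function.uncurry F)
  measurable_subgradient : Measurable (Function.uncurry G)
  convexOn : ∀ s, ConvexOn ℝ X (fun x => F x s)
  subgradient : ∀ s, ∀ x ∈ X, G x s ∈ subdifferentialOn X (fun y => F y s) x
  integrable : ∀ i, ∀ x ∈ X, Integrable (F x) (Q i)

/-- The objective `f(x) = (1/n) ∑ i, f_i(x)` with `f_i(x) = E_{ξ ∼ Q i} F(x; ξ)`. -/
def objective {E Ξ : Type*} [MeasurableSpace Ξ] {n : ℕ}
    (Q : Fin n → Measure Ξ) (F : E → Ξ → ℝ) (x : E) : ℝ :=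
  (1 / (n : ℝ)) * ∑ i, ∫ s, F x s ∂(Q i)

/-- The σ-algebra generated by the tokens and the samples at the times `1, …, t`. -/
abbrev history {Ω Ξ : Type*} [MeasurableSpace Ξ] {n : ℕ}
    (token : ℕ → Ω → Fin n) (ξ : ℕ → Ω → Ξ) (t : ℕ) : MeasurableSpace Ω :=
  ⨆ s ∈ Set.Icc 1 t, (MeasurableSpace.comap (token s) ⊤ ⊔
    MeasurableSpace.comap (ξ s) inferInstance)

/-- At each time `t ≥ 1` the token sits at `token t` and a sample `ξ t` is drawn from the local
distribution `Q (token t)`, afresh given the past and `token t`; then the token moves from `i`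
to `j` with probability `P i j`, independently of the rest of the past.  The law of the first
token is arbitrary. -/
structure IsTokenSampling {Ω : Type*} [MeasurableSpace Ω] (μ : Measure Ω)
    {Ξ : Type*} [MeasurableSpace Ξ] {n : ℕ}
    (P : Matrix (Fin n) (Fin n) ℝ) (Q : Fin n → Measure Ξ)
    (token : ℕ → Ω → Fin n) (ξ : ℕ → Ω → Ξ) : Prop where
  measurable_token : ∀ t, Measurable (token t)
  measurable_sample : ∀ t, Measurable (ξ t)
  first : ∀ (j : Fin n) (A : Set Ξ), MeasurableSet A →
    μ {ω | token 1 ω = j ∧ ξ 1 ω ∈ A} = μ {ω | token 1 ω = j} * Q j A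
  step : ∀ t, 1 ≤ t → ∀ (j : Fin n) (A : Set Ξ), MeasurableSet A →
    μ[Set.indicator {ω | token (t + 1) ω = j ∧ ξ (t + 1) ω ∈ A} (fun _ => (1 : ℝ)) |
        history token ξ t]
      =ᵐ[μ] fun ω => P (token t ω) j * (Q j).real A

/-- The Markov incremental mirror descent iterates: `x 1` is a fixed point of `X` and, for
`t ≥ 1`, `x (t + 1)` minimizes `⟨g(t), z⟩ + D(z, x t) / α(t)` over `z ∈ X`, where
`g(t) = G(x t; ξ t)` is the subgradient at the current sample. -/
structure IsMirrorDescent {E : Type*} [NormedAddCommGroup E] [NormedSpace ℝ E]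
    {Ω Ξ : Type*} (X : Set E) (ψ : E → ℝ) (G : E → Ξ → StrongDual ℝ E) (α : ℕ → ℝ)
    (ξ : ℕ → Ω → Ξ) (x : ℕ → Ω → E) : Prop where
  first : ∃ x₁ ∈ X, ∀ ω, x 1 ω = x₁
  mem : ∀ t, 1 ≤ t → ∀ ω, x (t + 1) ω ∈ X
  argmin : ∀ t, 1 ≤ t → ∀ ω,
    IsMinOn (fun z => G (x t ω) (ξ t ω) z + (1 / α t) * bregman ψ X z (x t ω)) X (x (t + 1) ω)

/-- The running average `(1/T) ∑_{t=1}^T x(t)`. -/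
def averageIterate {E : Type*} [NormedAddCommGroup E] [NormedSpace ℝ E]
    {Ω : Type*} (x : ℕ → Ω → E) (T : ℕ) (ω : Ω) : E :=
  (1 / (T : ℝ)) • ∑ t ∈ Finset.Icc 1 T, x t ω

end

open ProbabilityTheory Filter Topology
open scoped ENNReal NNReal Matrix

/-!
Write `τ = ⌊tauMix P T⌋`. The chain contracts at rate `σ₂(P)`, so the law of the token at time
`t + τ`, given the history before time `t`, is within `2 / T` of uniform in `ℓ¹`. Relative to the
iterate `x(t)`, the sample drawn at time `t + τ` is therefore almost a sample from the average of
the `Q i`. Since the iterates move by at most `α(t) ‖g(t)‖` per step, replacing `x(t)` by `x(t + τ)`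
costs only a drift of order `τ α(t) L²`. The gap `∑ t, f(x(t)) - f(x⋆)` thus splits into a sampling
error, a drift, the regret of mirror descent on the sampled losses, and `τ` boundary terms of size
at most `R L`.

In expectation the sampling error is of the order of the mixing error. For the high-probability
bound, the errors at times in a fixed residue class modulo `τ + 1` are martingale differences up to
the mixing error, and the convexity of `exp` combines the sub-Gaussian bounds on the `τ + 1` classes
into one tail bound.
-/

section Mixing

section SingularValues

variable {V W : Type*} [NormedAddCommGroup V] [InnerProductSpace ℝ V] [FiniteDimensional ℝ V]
  [NormedAddCommGroup W] [InnerProductSpace ℝ W] [FiniteDimensional ℝ W]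

open LinearMap in
theorem norm_sq_map_eq_sum_eigenvalues_mul_sq {d : ℕ} (hd : Module.finrank ℝ V = d)
    (A : V →ₗ[ℝ] W) (v : V) :
    ‖A v‖ ^ 2 = ∑ i, A.isSymmetric_adjoint_comp_self.eigenvalues hd i *
      (A.isSymmetric_adjoint_comp_self.eigenvectorBasis hd).repr v i ^ 2 := by
  set b := A.isSymmetric_adjoint_comp_self.eigenvectorBasis hd
  rw [← real_inner_self_eq_norm_sq, ← adjoint_inner_left, ← b.repr.inner_map_map, PiLp.inner_apply]
  refine Finset.sum_congr rfl fun i _ => ?_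
  have heigen : b.repr (adjoint A (A v)) i = _ :=
    A.isSymmetric_adjoint_comp_self.eigenvectorBasis_apply_self_apply hd v i
  rw [heigen, RCLike.inner_apply, conj_trivial, RCLike.ofReal_real_eq_id, id_eq]
  ring

open LinearMap in
/-- As `σ₂ < 1`, the fixed vector `e` of `A† A` spans the top eigenspace, so its orthogonal
complement is spanned by the remaining eigenvectors. -/
theorem norm_map_le_singularValues_one_mul_norm {A : V →ₗ[ℝ] W} (hσ : A.singularValues 1 < 1)
    {e v : V} (he₀ : e ≠ 0) (he : adjoint A (A e) = e) (hv : inner ℝ e v = 0) :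
    ‖A v‖ ≤ A.singularValues 1 * ‖v‖ := by
  have hA := A.isSymmetric_adjoint_comp_self
  set b := hA.eigenvectorBasis rfl with hb
  set ev := hA.eigenvalues rfl
  have hσ0 : 0 ≤ A.singularValues 1 := A.singularValues_nonneg 1
  have ev_le : ∀ i, i.val ≠ 0 → ev i ≤ A.singularValues 1 ^ 2 := fun i hi => by
    rw [A.sq_singularValues_of_lt rfl (by omega)]
    exact hA.eigenvalues_antitone rfl (Fin.le_def.2 (by dsimp only; omega))
  have repr_e : ∀ i, i.val ≠ 0 → b.repr e i = 0 := fun i hi => by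
    have heigen : b.repr (adjoint A (A e)) i = ev i * b.repr e i :=
      hA.eigenvectorBasis_apply_self_apply rfl e i
    rw [he] at heigen
    have hlt : ev i < 1 := (ev_le i hi).trans_lt (by nlinarith)
    exact (mul_eq_zero.1 (by linarith : (1 - ev i) * b.repr e i = 0)).resolve_left (by linarith)
  have repr_v : ∀ i, i.val = 0 → b.repr v i = 0 := fun i hi => by
    have eq_zero_of_ne : ∀ j, j ≠ i → b.repr e j = 0 := fun j hj =>
      repr_e j fun h => hj (Fin.ext (h.trans hi.symm))
    have hne : b.repr e i ≠ 0 := fun h => he₀ <| b.repr.injective <| PiLp.ext fun j => by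
      rw [map_zero, PiLp.zero_apply]
      exact (eq_or_ne j i).elim (fun hj => hj ▸ h) (eq_zero_of_ne j)
    rw [← b.repr.inner_map_map, PiLp.inner_apply, Finset.sum_eq_single i
      (fun j _ hj => by rw [eq_zero_of_ne j hj, inner_zero_left]) (by simp)] at hv
    simpa [hne] using hv
  refine le_of_sq_le_sq ?_ (mul_nonneg hσ0 (norm_nonneg v))
  rw [norm_sq_map_eq_sum_eigenvalues_mul_sq rfl, mul_pow, ← b.repr.norm_map v,
    EuclideanSpace.norm_sq_eq, Finset.mul_sum]
  refine Finset.sum_le_sum fun i _ => ?_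
  rw [Real.norm_eq_abs, sq_abs, ← hb]
  by_cases hi : i.val = 0
  · simp [repr_v i hi]
  · exact mul_le_mul_of_nonneg_right (ev_le i hi) (sq_nonneg _)

end SingularValues

variable {n : ℕ} {P : Matrix (Fin n) (Fin n) ℝ}

theorem secondSingularValue_nonneg (P : Matrix (Fin n) (Fin n) ℝ) : 0 ≤ secondSingularValue P :=
  LinearMap.singularValues_nonneg _ 1

theorem norm_mulVec_le_secondSingularValue_mul_norm (hP : P ∈ doublyStochastic ℝ (Fin n))
    (hσ : secondSingularValue P < 1) {v : Fin n → ℝ} (hv : ∑ i, v i = 0) :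
    ‖WithLp.toLp 2 (P *ᵥ v)‖ ≤ secondSingularValue P * ‖WithLp.toLp 2 v‖ := by
  obtain rfl | hn := Nat.eq_zero_or_pos n
  · rw [Subsingleton.elim (P *ᵥ v) 0, Subsingleton.elim v 0, WithLp.toLp_zero, norm_zero, mul_zero]
  refine norm_map_le_singularValues_one_mul_norm (A := Matrix.toEuclideanLin P)
    (e := WithLp.toLp 2 1) hσ ?_ ?_ ?_
  · intro h
    simpa using congrArg (fun w : EuclideanSpace ℝ (Fin n) => w ⟨0, hn⟩) h
  · simp only [← Matrix.toEuclideanLin_conjTranspose_eq_adjoint, Matrix.toLpLin_toLp,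
      Matrix.toLin'_apply, mulVec_one_of_mem_doublyStochastic hP,
      Matrix.conjTranspose_eq_transpose_of_trivial, Matrix.mulVec_transpose,
      one_vecMul_of_mem_doublyStochastic hP]
  · simpa [PiLp.inner_apply] using hv

theorem norm_pow_mulVec_le (hP : P ∈ doublyStochastic ℝ (Fin n))
    (hσ : secondSingularValue P < 1) {v : Fin n → ℝ} (hv : ∑ i, v i = 0) (k : ℕ) :
    ‖WithLp.toLp 2 (P ^ k *ᵥ v)‖ ≤ secondSingularValue P ^ k * ‖WithLp.toLp 2 v‖ := by
  induction k with
  | zero => simp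
  | succ k ih =>
    have hsum : ∑ i, (P ^ k *ᵥ v) i = 0 :=
      (sum_mulVec_of_mem_doublyStochastic (pow_mem hP k)).trans hv
    calc ‖WithLp.toLp 2 (P ^ (k + 1) *ᵥ v)‖
        = ‖WithLp.toLp 2 (P *ᵥ (P ^ k *ᵥ v))‖ := by rw [Matrix.mulVec_mulVec, ← pow_succ']
      _ ≤ secondSingularValue P * ‖WithLp.toLp 2 (P ^ k *ᵥ v)‖ :=
          norm_mulVec_le_secondSingularValue_mul_norm hP hσ hsum
      _ ≤ secondSingularValue P * (secondSingularValue P ^ k * ‖WithLp.toLp 2 v‖) :=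
          mul_le_mul_of_nonneg_left ih (secondSingularValue_nonneg P)
      _ = secondSingularValue P ^ (k + 1) * ‖WithLp.toLp 2 v‖ := by ring

theorem norm_pow_row_sub_le (hP : P ∈ doublyStochastic ℝ (Fin n))
    (hσ : secondSingularValue P < 1) (k : ℕ) (i : Fin n) :
    ‖WithLp.toLp 2 fun j => (P ^ k) i j - 1 / (n : ℝ)‖ ≤ secondSingularValue P ^ k := by
  have hn : (n : ℝ) ≠ 0 := Nat.cast_ne_zero.2 (Fin.pos_iff_nonempty.2 ⟨i⟩).ne'
  set w : Fin n → ℝ := fun j => (P ^ k) i j - 1 / (n : ℝ) with hw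
  have hsum : ∑ j, w j = 0 := by
    simp [hw, sum_row_of_mem_doublyStochastic (pow_mem hP k) i, hn]
  have hsq : ‖WithLp.toLp 2 w‖ ^ 2 = (P ^ k *ᵥ w) i := by
    calc ‖WithLp.toLp 2 w‖ ^ 2
      _ = ∑ j, w j * w j := by
        simp only [EuclideanSpace.norm_sq_eq, Real.norm_eq_abs, sq_abs, ← sq]
      _ = ∑ j, (P ^ k) i j * w j - 1 / (n : ℝ) * ∑ j, w j := by
        rw [Finset.mul_sum, ← Finset.sum_sub_distrib]
        exact Finset.sum_congr rfl fun j _ => by simp only [hw]; ring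
      _ = (P ^ k *ᵥ w) i := by rw [hsum, mul_zero, sub_zero]; rfl
  have hle : ‖WithLp.toLp 2 w‖ ^ 2 ≤ secondSingularValue P ^ k * ‖WithLp.toLp 2 w‖ :=
    calc ‖WithLp.toLp 2 w‖ ^ 2 ≤ ‖WithLp.toLp 2 (P ^ k *ᵥ w) i‖ :=
          hsq.trans_le (Real.le_norm_self _)
      _ ≤ ‖WithLp.toLp 2 (P ^ k *ᵥ w)‖ := PiLp.norm_apply_le _ i
      _ ≤ _ := norm_pow_mulVec_le hP hσ hsum k
  have hσk : 0 ≤ secondSingularValue P ^ k := pow_nonneg (secondSingularValue_nonneg P) k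
  by_contra! hlt
  nlinarith

theorem sum_abs_pow_row_sub_le (hP : P ∈ doublyStochastic ℝ (Fin n))
    (hσ : secondSingularValue P < 1) (k : ℕ) (i : Fin n) :
    ∑ j, |(P ^ k) i j - 1 / (n : ℝ)| ≤ √n * secondSingularValue P ^ k := by
  refine (le_of_sq_le_sq ?_ (by positivity)).trans
    (mul_le_mul_of_nonneg_left (norm_pow_row_sub_le hP hσ k i) (Real.sqrt_nonneg n))
  rw [mul_pow, Real.sq_sqrt (Nat.cast_nonneg n), EuclideanSpace.norm_sq_eq]
  simpa using sq_sum_le_card_mul_sum_sq (s := Finset.univ)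
    (f := fun j => |(P ^ k) i j - 1 / (n : ℝ)|)

theorem sum_abs_vecMul_pow_sub_le (hP : P ∈ doublyStochastic ℝ (Fin n))
    (hσ : secondSingularValue P < 1) {w : Fin n → ℝ} (hw : w ∈ stdSimplex ℝ (Fin n)) (k : ℕ) :
    ∑ j, |(w ᵥ* P ^ k) j - 1 / (n : ℝ)| ≤ √n * secondSingularValue P ^ k := by
  have hsub : ∀ j, (w ᵥ* P ^ k) j - 1 / (n : ℝ) = ∑ i, w i * ((P ^ k) i j - 1 / (n : ℝ)) := by
    intro j
    simp_rw [mul_sub, Finset.sum_sub_distrib, ← Finset.sum_mul, hw.2, one_mul]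
    rfl
  calc ∑ j, |(w ᵥ* P ^ k) j - 1 / (n : ℝ)|
      ≤ ∑ j, ∑ i, w i * |(P ^ k) i j - 1 / (n : ℝ)| := by
        refine Finset.sum_le_sum fun j _ => ?_
        rw [hsub]
        refine (Finset.abs_sum_le_sum_abs _ _).trans_eq (Finset.sum_congr rfl fun i _ => ?_)
        rw [abs_mul, abs_of_nonneg (hw.1 i)]
    _ = ∑ i, w i * ∑ j, |(P ^ k) i j - 1 / (n : ℝ)| := by
        rw [Finset.sum_comm]
        simp_rw [Finset.mul_sum]
    _ ≤ ∑ i, w i * (√n * secondSingularValue P ^ k) := by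
        gcongr with i
        · exact hw.1 i
        · exact sum_abs_pow_row_sub_le hP hσ k i
    _ = √n * secondSingularValue P ^ k := by rw [← Finset.sum_mul, hw.2, one_mul]

end Mixing

section Prox

variable {E : Type*} [NormedAddCommGroup E] [NormedSpace ℝ E] {X : Set E} {ψ : E → ℝ} {R : ℝ}

theorem bregman_self (x : E) : bregman ψ X x x = 0 := by
  simp [bregman]

theorem continuousOn_bregman_left (hψ : ContinuousOn ψ X) (y : E) :
    ContinuousOn (fun x => bregman ψ X x y) X :=
  (hψ.sub continuousOn_const).sub
    ((fderivWithin ℝ ψ X y).continuous.comp (continuous_sub_right y)).continuousOn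

theorem IsProxSetup.half_sq_norm_le_bregman (h : IsProxSetup X ψ R) {x y : E} (hx : x ∈ X)
    (hy : y ∈ X) : (1 / 2) * ‖x - y‖ ^ 2 ≤ bregman ψ X x y := by
  have := h.stronglyConvex y hy x hx
  rw [norm_sub_rev] at this
  unfold bregman
  linarith

theorem IsProxSetup.bregman_nonneg (h : IsProxSetup X ψ R) {x y : E} (hx : x ∈ X)
    (hy : y ∈ X) : 0 ≤ bregman ψ X x y :=
  le_trans (by positivity) (h.half_sq_norm_le_bregman hx hy)

theorem IsProxSetup.norm_sub_le (h : IsProxSetup X ψ R) (hR : 0 ≤ R) {x y : E} (hx : x ∈ X)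
    (hy : y ∈ X) : ‖x - y‖ ≤ R := by
  refine le_of_sq_le_sq ?_ hR
  linarith [h.half_sq_norm_le_bregman hx hy, h.bregman_le x hx y hy]

theorem hasFDerivWithinAt_add_bregman (hψ : DifferentiableOn ℝ ψ X) (g : StrongDual ℝ E) (a : ℝ)
    (x : E) {b : E} (hb : b ∈ X) :
    HasFDerivWithinAt (fun z => g z + a * bregman ψ X z x)
      (g + a • (fderivWithin ℝ ψ X b - fderivWithin ℝ ψ X x)) X b := by
  have hlin : HasFDerivWithinAt (fun z => fderivWithin ℝ ψ X x (z - x))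
      (fderivWithin ℝ ψ X x) X b :=
    (((fderivWithin ℝ ψ X x).hasFDerivAt (x := b - x)).comp b
      ((hasFDerivAt_id b).sub_const x)).hasFDerivWithinAt
  exact g.hasFDerivWithinAt.add
    ((((hψ b hb).hasFDerivWithinAt.sub_const _).sub hlin).const_mul a)

theorem bregman_add_bregman_le_of_isMinOn (hX : Convex ℝ X) (hψ : DifferentiableOn ℝ ψ X)
    {g : StrongDual ℝ E} {a : ℝ} (ha : 0 < a) {x b z : E} (hb : b ∈ X) (hz : z ∈ X)
    (hmin : IsMinOn (fun z => g z + (1 / a) * bregman ψ X z x) X b) :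
    bregman ψ X b x + bregman ψ X z b ≤ a * g (z - b) + bregman ψ X z x := by
  have hopt := hmin.localize.hasFDerivWithinAt_nonneg
    (hasFDerivWithinAt_add_bregman hψ g (1 / a) x hb)
    (sub_mem_posTangentConeAt_of_segment_subset (hX.segment_subset hb hz))
  simp only [add_apply, smul_apply, sub_apply, smul_eq_mul] at hopt
  have hopt' : 0 ≤ a * g (z - b) +
      (fderivWithin ℝ ψ X b (z - b) - fderivWithin ℝ ψ X x (z - b)) := by
    have := mul_nonneg ha.le hopt
    rwa [mul_add, ← mul_assoc, mul_one_div_cancel ha.ne', one_mul] at this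
  have hsplit : fderivWithin ℝ ψ X x (z - b) =
      fderivWithin ℝ ψ X x (z - x) - fderivWithin ℝ ψ X x (b - x) := by
    rw [← map_sub, sub_sub_sub_cancel_right]
  unfold bregman
  linarith

theorem IsProxSetup.apply_sub_le_of_isMinOn (h : IsProxSetup X ψ R) {g : StrongDual ℝ E} {a : ℝ}
    (ha : 0 < a) {x b z : E} (hx : x ∈ X) (hb : b ∈ X) (hz : z ∈ X)
    (hmin : IsMinOn (fun z => g z + (1 / a) * bregman ψ X z x) X b) :
    g (x - z) ≤ (1 / a) * (bregman ψ X z x - bregman ψ X z b) + a / 2 * ‖g‖ ^ 2 := by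
  have hthree := bregman_add_bregman_le_of_isMinOn h.convex h.differentiableOn ha hb hz hmin
  have hstrong := h.half_sq_norm_le_bregman hb hx
  have hdual : a * g (x - b) ≤ a * (‖g‖ * ‖b - x‖) := by
    rw [norm_sub_rev]
    exact mul_le_mul_of_nonneg_left ((le_abs_self _).trans (g.le_opNorm _)) ha.le
  have hscaled : a * g (x - z) ≤
      (bregman ψ X z x - bregman ψ X z b) + a ^ 2 / 2 * ‖g‖ ^ 2 := by
    rw [← sub_sub_sub_cancel_right x z b, map_sub]
    linarith [sq_nonneg (a * ‖g‖ - ‖b - x‖)]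
  calc g (x - z) = (1 / a) * (a * g (x - z)) := by field_simp
    _ ≤ (1 / a) * ((bregman ψ X z x - bregman ψ X z b) + a ^ 2 / 2 * ‖g‖ ^ 2) := by gcongr
    _ = _ := by field_simp

theorem IsProxSetup.norm_sub_le_of_isMinOn (h : IsProxSetup X ψ R) {g : StrongDual ℝ E} {a : ℝ}
    (ha : 0 < a) {x b : E} (hx : x ∈ X) (hb : b ∈ X)
    (hmin : IsMinOn (fun z => g z + (1 / a) * bregman ψ X z x) X b) :
    ‖b - x‖ ≤ a * ‖g‖ := by
  have hthree := bregman_add_bregman_le_of_isMinOn h.convex h.differentiableOn ha hb hx hmin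
  rw [bregman_self, add_zero] at hthree
  have hbx := h.half_sq_norm_le_bregman hb hx
  have hxb := h.half_sq_norm_le_bregman hx hb
  rw [norm_sub_rev] at hxb
  have hdual : a * g (x - b) ≤ a * (‖g‖ * ‖b - x‖) := by
    rw [norm_sub_rev]
    exact mul_le_mul_of_nonneg_left ((le_abs_self _).trans (g.le_opNorm _)) ha.le
  rcases (norm_nonneg (b - x)).eq_or_lt with h0 | hpos
  · rw [← h0]
    positivity
  · exact le_of_mul_le_mul_right (by linarith) hpos

end Prox

section MeasurableArgmin

section WellPosed

variable {E : Type*} [PseudoMetricSpace E] {X : Set E} {Ω : Type*} {H : Ω → E → ℝ} {b : Ω → E}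

theorem exists_lt_add_of_dense {ι : Type*} {d : ι → X} (hd : DenseRange d) {h : E → ℝ}
    (hh : ContinuousOn h X) {y : E} (hy : y ∈ X) {c : ℝ} (hc : h y < c) : ∃ i, h (d i) < c :=
  hd.exists_mem_open ((continuousOn_iff_continuous_domRestrict.1 hh).isOpen_preimage _ isOpen_Iio)
    ⟨⟨y, hy⟩, hc⟩

variable [MeasurableSpace Ω]

theorem measurable_apply_of_isMinOn (hX : TopologicalSpace.IsSeparable X)
    (hm : ∀ z ∈ X, Measurable fun ω => H ω z) (hc : ∀ ω, ContinuousOn (H ω) X)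
    (hb : ∀ ω, b ω ∈ X) (hmin : ∀ ω, IsMinOn (H ω) X (b ω)) :
    Measurable fun ω => H ω (b ω) := by
  rcases isEmpty_or_nonempty Ω with hΩ | ⟨⟨ω₀⟩⟩
  · exact measurable_of_empty _
  have : Nonempty X := ⟨⟨b ω₀, hb ω₀⟩⟩
  have := hX.separableSpace
  obtain ⟨d, hd⟩ := TopologicalSpace.exists_dense_seq X
  refine measurable_of_Iio fun c => ?_
  have hset : (fun ω => H ω (b ω)) ⁻¹' Set.Iio c = ⋃ i, {ω | H ω (d i) < c} := by
    ext ω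
    simp only [Set.mem_preimage, Set.mem_Iio, Set.mem_iUnion, Set.mem_ofPred_eq]
    exact ⟨exists_lt_add_of_dense hd (hc ω) (hb ω), fun ⟨i, hi⟩ => (hmin ω (d i).2).trans_lt hi⟩
  rw [hset]
  exact .iUnion fun i => measurableSet_lt (hm _ (d i).2) measurable_const

/-- The first point of a dense sequence that is `1 / (k + 1)`-optimal is a measurable function,
and by the growth condition it converges to the minimizer as `k → ∞`. -/
theorem measurable_of_isMinOn_of_sq_dist_le [MeasurableSpace E] [BorelSpace E]
    (hX : TopologicalSpace.IsSeparable X)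
    (hm : ∀ z ∈ X, Measurable fun ω => H ω z) (hc : ∀ ω, ContinuousOn (H ω) X)
    (hb : ∀ ω, b ω ∈ X) (hmin : ∀ ω, IsMinOn (H ω) X (b ω)) {c : ℝ} (hc0 : 0 ≤ c)
    (hgrow : ∀ ω, ∀ z ∈ X, dist z (b ω) ^ 2 ≤ c * (H ω z - H ω (b ω))) :
    Measurable b := by
  classical
  rcases isEmpty_or_nonempty Ω with hΩ | ⟨⟨ω₀⟩⟩
  · exact measurable_of_empty b
  have : Nonempty X := ⟨⟨b ω₀, hb ω₀⟩⟩
  have := hX.separableSpace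
  obtain ⟨d, hd⟩ := TopologicalSpace.exists_dense_seq X
  have hex : ∀ (k : ℕ) ω, ∃ i, H ω (d i) < H ω (b ω) + 1 / ((k : ℝ) + 1) := fun k ω =>
    exists_lt_add_of_dense hd (hc ω) (hb ω) (lt_add_of_pos_right _ (by positivity))
  refine measurable_of_tendsto_metrizable
    (f := fun (k : ℕ) ω => (d (Nat.find (hex k ω)) : E)) (fun k => ?_) ?_
  · exact Measurable.find (f := fun i _ => (d i : E)) (fun i => measurable_const)
      (fun i => measurableSet_lt (hm _ (d i).2)
        ((measurable_apply_of_isMinOn hX hm hc hb hmin).add_const _)) (hex k)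
  · refine tendsto_pi_nhds.2 fun ω => tendsto_iff_dist_tendsto_zero.2 ?_
    have hle : ∀ k : ℕ, dist (d (Nat.find (hex k ω)) : E) (b ω) ≤ √(c * (1 / ((k : ℝ) + 1))) :=
      fun k => Real.le_sqrt_of_sq_le <| (hgrow ω _ (d _).2).trans <|
        mul_le_mul_of_nonneg_left (by linarith [Nat.find_spec (hex k ω)]) hc0
    have hlim := (Real.continuous_sqrt.tendsto _).comp
      ((tendsto_one_div_add_atTop_nhds_zero_nat (𝕜 := ℝ)).const_mul c)
    rw [mul_zero, Real.sqrt_zero] at hlim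
    exact squeeze_zero (fun k => dist_nonneg) hle hlim

end WellPosed

variable {E : Type*} [NormedAddCommGroup E] [NormedSpace ℝ E] [MeasurableSpace E] [BorelSpace E]
  {X : Set E} {ψ : E → ℝ} {R : ℝ}

/-- The directional derivative at `y` is a limit of difference quotients continuous in `y`. -/
theorem measurable_bregman_right (hX : Convex ℝ X) (hψ : DifferentiableOn ℝ ψ X) {z : E}
    (hz : z ∈ X) : Measurable fun y : X => bregman ψ X z y := by
  have hcont : Continuous fun y : X => ψ y :=
    continuousOn_iff_continuous_domRestrict.1 hψ.continuousOn
  let seg : ℕ → X → X := fun k y => ⟨(y : E) + (1 / ((k : ℝ) + 1)) • (z - y),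
    hX.add_smul_sub_mem y.2 hz
      ⟨by positivity, by rw [div_le_one] <;> linarith [k.cast_nonneg (α := ℝ)]⟩⟩
  have hseg : ∀ k, Continuous (seg k) := fun k => by fun_prop
  have hderiv : Measurable fun y : X => fderivWithin ℝ ψ X y (z - y) := by
    refine measurable_of_tendsto_metrizable
      (f := fun (k : ℕ) (y : X) => ((k : ℝ) + 1) • (ψ (seg k y) - ψ y))
      (fun k => (((hcont.comp (hseg k)).sub hcont).const_smul ((k : ℝ) + 1)).measurable) ?_
    refine tendsto_pi_nhds.2 fun y => (hψ y y.2).hasFDerivWithinAt.lim ?_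
      (.of_forall fun k => (seg k y).2) (tendsto_const_nhds.congr fun k => ?_)
    · simpa using (tendsto_one_div_add_atTop_nhds_zero_nat (𝕜 := ℝ)).smul_const (z - (y : E))
    · rw [smul_smul, mul_one_div_cancel (by positivity), one_smul]
  exact (measurable_const.sub hcont.measurable).sub hderiv

theorem IsProxSetup.measurable_of_isMinOn (h : IsProxSetup X ψ R) {Ω : Type*} [MeasurableSpace Ω]
    {x b : Ω → E} {g : Ω → StrongDual ℝ E} {a : ℝ} (ha : 0 < a)
    (hx : Measurable x) (hxX : ∀ ω, x ω ∈ X) (hg : Measurable g) (hbX : ∀ ω, b ω ∈ X)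
    (hmin : ∀ ω, IsMinOn (fun z => g ω z + (1 / a) * bregman ψ X z (x ω)) X (b ω)) :
    Measurable b := by
  refine measurable_of_isMinOn_of_sq_dist_le h.isCompact.isSeparable (fun z hz => ?_) (fun ω => ?_)
    hbX hmin (c := 2 * a) (by positivity) fun ω z hz => ?_
  · exact (hg.apply_continuousLinearMap z).add (((measurable_bregman_right h.convex
      h.differentiableOn hz).comp (hx.subtype_mk (h := hxX))).const_mul _)
  · exact (g ω).continuous.continuousOn.add
      (continuousOn_const.mul (continuousOn_bregman_left h.differentiableOn.continuousOn (x ω)))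
  · have hthree := bregman_add_bregman_le_of_isMinOn h.convex h.differentiableOn ha (hbX ω) hz
      (hmin ω)
    have hstrong := h.half_sq_norm_le_bregman hz (hbX ω)
    have hgap : a * (g ω z + (1 / a) * bregman ψ X z (x ω) -
        (g ω (b ω) + (1 / a) * bregman ψ X (b ω) (x ω))) =
        a * g ω (z - b ω) + bregman ψ X z (x ω) - bregman ψ X (b ω) (x ω) := by
      rw [map_sub]
      field_simp
      ring
    rw [dist_eq_norm, mul_assoc, hgap]
    linarith

end MeasurableArgmin

section MirrorPath

/-- A deterministic mirror descent path `y 0, y 1, …` in `X` with gradients `g t` and positive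
non-increasing step sizes `α t`. -/
structure IsMirrorPath {E : Type*} [NormedAddCommGroup E] [NormedSpace ℝ E]
    (X : Set E) (ψ : E → ℝ) (α : ℕ → ℝ) (g : ℕ → StrongDual ℝ E) (y : ℕ → E) : Prop where
  mem : ∀ t, y t ∈ X
  step_pos : ∀ t, 0 < α t
  step_antitone : Antitone α
  isMinOn : ∀ t, IsMinOn (fun z => g t z + (1 / α t) * bregman ψ X z (y t)) X (y (t + 1))

/-- The pathwise cost, when losses are sampled with a lag `τ`, of the drift of the iterates over
`τ` steps plus the gradient part of the regret after time `τ`.  Here `u t` and `v t` are the squared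
norms of the gradients at `y t` for the samples of the times `t + τ` and `t`. -/
noncomputable def driftRegretCost (α : ℕ → ℝ) (τ N : ℕ) (u v : ℕ → ℝ) : ℝ :=
  ∑ t ∈ Finset.range N, ∑ j ∈ Finset.range τ, α (t + j) * ((u t + v (t + j)) / 2) +
    ∑ t ∈ Finset.range N, α (τ + t) / 2 * v (τ + t)

namespace IsMirrorPath

variable {E : Type*} [NormedAddCommGroup E] [NormedSpace ℝ E] {X : Set E} {ψ : E → ℝ} {R : ℝ}
  {α : ℕ → ℝ} {g : ℕ → StrongDual ℝ E} {y : ℕ → E}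

theorem shift (hy : IsMirrorPath X ψ α g y) (a : ℕ) :
    IsMirrorPath X ψ (fun t => α (a + t)) (fun t => g (a + t)) fun t => y (a + t) where
  mem t := hy.mem (a + t)
  step_pos t := hy.step_pos (a + t)
  step_antitone _ _ h := hy.step_antitone (Nat.add_le_add_left h a)
  isMinOn t := hy.isMinOn (a + t)

theorem sum_apply_sub_le_sub (hy : IsMirrorPath X ψ α g y) (h : IsProxSetup X ψ R) {z : E}
    (hz : z ∈ X) (N : ℕ) :
    ∑ t ∈ Finset.range (N + 1), g t (y t - z) ≤
      (1 / α N) * (R ^ 2 / 2 - bregman ψ X z (y (N + 1))) +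
        ∑ t ∈ Finset.range (N + 1), α t / 2 * ‖g t‖ ^ 2 := by
  have hstep : ∀ t, g t (y t - z) ≤
      (1 / α t) * (bregman ψ X z (y t) - bregman ψ X z (y (t + 1))) + α t / 2 * ‖g t‖ ^ 2 :=
    fun t => h.apply_sub_le_of_isMinOn (hy.step_pos t) (hy.mem t) (hy.mem _) hz (hy.isMinOn t)
  have hslack : ∀ t, 0 ≤ R ^ 2 / 2 - bregman ψ X z (y t) := fun t => by
    linarith [h.bregman_le z hz (y t) (hy.mem t)]
  induction N with
  | zero =>
    rw [zero_add, Finset.sum_range_one, Finset.sum_range_one]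
    linarith [hstep 0, mul_nonneg (one_div_nonneg.2 (hy.step_pos 0).le) (hslack 0)]
  | succ N ih =>
    rw [Finset.sum_range_succ, Finset.sum_range_succ _ (N + 1)]
    have hα : 1 / α N ≤ 1 / α (N + 1) :=
      one_div_le_one_div_of_le (hy.step_pos _) (hy.step_antitone N.le_succ)
    linarith [hstep (N + 1), mul_le_mul_of_nonneg_right hα (hslack (N + 1))]

theorem sum_apply_sub_le (hy : IsMirrorPath X ψ α g y) (h : IsProxSetup X ψ R) {z : E}
    (hz : z ∈ X) (N : ℕ) :
    ∑ t ∈ Finset.range (N + 1), g t (y t - z) ≤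
      R ^ 2 / (2 * α N) + ∑ t ∈ Finset.range (N + 1), α t / 2 * ‖g t‖ ^ 2 := by
  refine (hy.sum_apply_sub_le_sub h hz N).trans ?_
  have hpos := hy.step_pos N
  have hdrop := mul_nonneg (one_div_nonneg.2 hpos.le) (h.bregman_nonneg hz (hy.mem (N + 1)))
  have hscale : R ^ 2 / (2 * α N) = (1 / α N) * (R ^ 2 / 2) := by field_simp
  linarith

theorem norm_sub_zero_le (hy : IsMirrorPath X ψ α g y) (h : IsProxSetup X ψ R) (k : ℕ) :
    ‖y k - y 0‖ ≤ ∑ j ∈ Finset.range k, α j * ‖g j‖ := by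
  induction k with
  | zero => simp
  | succ k ih =>
    rw [Finset.sum_range_succ, ← sub_add_sub_cancel' (y k) (y 0) (y (k + 1))]
    exact (norm_add_le _ _).trans (add_le_add ih
      (h.norm_sub_le_of_isMinOn (hy.step_pos k) (hy.mem k) (hy.mem _) (hy.isMinOn k)))

theorem norm_mul_norm_sub_le (hy : IsMirrorPath X ψ α g y) (h : IsProxSetup X ψ R)
    (γ : StrongDual ℝ E) (t τ : ℕ) :
    ‖γ‖ * ‖y (t + τ) - y t‖ ≤
      ∑ j ∈ Finset.range τ, α (t + j) * ((‖γ‖ ^ 2 + ‖g (t + j)‖ ^ 2) / 2) := by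
  refine (mul_le_mul_of_nonneg_left ((hy.shift t).norm_sub_zero_le h τ) (norm_nonneg γ)).trans ?_
  rw [Finset.mul_sum]
  refine Finset.sum_le_sum fun j _ => ?_
  have := mul_le_mul_of_nonneg_left (two_mul_le_add_sq ‖γ‖ ‖g (t + j)‖) (hy.step_pos (t + j)).le
  linarith

variable {Fs : ℕ → E → ℝ} {Gs : ℕ → E → StrongDual ℝ E}

theorem loss_sub_le (hy : IsMirrorPath X ψ α (fun t => Gs t (y t)) y) (h : IsProxSetup X ψ R)
    (hsub : ∀ t, ∀ z ∈ X, Gs t z ∈ subdifferentialOn X (Fs t) z) {z : E} (hz : z ∈ X) (t τ : ℕ) :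
    Fs (t + τ) (y t) - Fs (t + τ) z ≤
      ∑ j ∈ Finset.range τ, α (t + j) *
          ((‖Gs (t + τ) (y t)‖ ^ 2 + ‖Gs (t + j) (y (t + j))‖ ^ 2) / 2) +
        Gs (t + τ) (y (t + τ)) (y (t + τ) - z) := by
  set γ := Gs (t + τ) (y t)
  have hregret : Fs (t + τ) (y (t + τ)) + Gs (t + τ) (y (t + τ)) (z - y (t + τ)) ≤ Fs (t + τ) z :=
    hsub (t + τ) (y (t + τ)) (hy.mem _) z hz
  have hlag : Fs (t + τ) (y t) + γ (y (t + τ) - y t) ≤ Fs (t + τ) (y (t + τ)) :=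
    hsub (t + τ) (y t) (hy.mem t) (y (t + τ)) (hy.mem _)
  have hdual : -γ (y (t + τ) - y t) ≤ ‖γ‖ * ‖y (t + τ) - y t‖ :=
    (neg_le_abs _).trans (γ.le_opNorm _)
  rw [← neg_sub, map_neg] at hregret
  linarith [hy.norm_mul_norm_sub_le h γ t τ]

theorem sum_gap_le (hy : IsMirrorPath X ψ α (fun t => Gs t (y t)) y) (h : IsProxSetup X ψ R)
    (hsub : ∀ t, ∀ z ∈ X, Gs t z ∈ subdifferentialOn X (Fs t) z) {z : E} (hz : z ∈ X)
    {f : E → ℝ} {C : ℝ} (hf : ∀ w ∈ X, f w - f z ≤ C) (τ N : ℕ) :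
    ∑ t ∈ Finset.range (N + 1 + τ), (f (y t) - f z) ≤
      ∑ t ∈ Finset.range (N + 1), (Fs (t + τ) z - Fs (t + τ) (y t) + (f (y t) - f z)) +
        driftRegretCost α τ (N + 1) (fun t => ‖Gs (t + τ) (y t)‖ ^ 2)
          (fun t => ‖Gs t (y t)‖ ^ 2) +
        R ^ 2 / (2 * α (τ + N)) + τ * C := by
  have hboundary : ∑ t ∈ Finset.range τ, (f (y (N + 1 + t)) - f z) ≤ τ * C := by
    simpa using Finset.sum_le_sum fun t (_ : t ∈ Finset.range τ) => hf _ (hy.mem (N + 1 + t))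
  have hloss := Finset.sum_le_sum fun t (_ : t ∈ Finset.range (N + 1)) =>
    hy.loss_sub_le h hsub hz t τ
  have hregret := (hy.shift τ).sum_apply_sub_le h hz N
  simp only [add_comm _ τ] at hloss ⊢
  rw [add_comm τ, Finset.sum_range_add]
  simp only [driftRegretCost, Finset.sum_add_distrib, Finset.sum_sub_distrib] at hloss hboundary ⊢
  linarith

end IsMirrorPath

theorem driftRegretCost_le {α : ℕ → ℝ} (hα : ∀ t, 0 ≤ α t) (hα' : Antitone α) {τ N : ℕ}
    {u v : ℕ → ℝ} {c : ℝ} (hc : 0 ≤ c) (hu : ∀ t, u t ≤ c) (hv : ∀ t, v t ≤ c) :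
    driftRegretCost α τ N u v ≤ (τ + 1 / 2) * c * ∑ t ∈ Finset.range N, α t := by
  have hdrift : ∀ t, ∑ j ∈ Finset.range τ, α (t + j) * ((u t + v (t + j)) / 2) ≤ τ * (α t * c) :=
    fun t => by
      have hterm : ∀ j ∈ Finset.range τ, α (t + j) * ((u t + v (t + j)) / 2) ≤ α t * c :=
        fun j _ => mul_le_mul_of_nonneg (hα' (Nat.le_add_right t j))
          (by linarith [hu t, hv (t + j)]) (hα _) hc
      simpa using Finset.sum_le_sum hterm
  have hregret : ∀ t, α (τ + t) / 2 * v (τ + t) ≤ 1 / 2 * (α t * c) := fun t => by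
    have := mul_le_mul_of_nonneg (hα' (Nat.le_add_left t τ)) (hv (τ + t)) (hα _) hc
    linarith
  calc driftRegretCost α τ N u v
      ≤ ∑ t ∈ Finset.range N, τ * (α t * c) + ∑ t ∈ Finset.range N, 1 / 2 * (α t * c) :=
        add_le_add (Finset.sum_le_sum fun t _ => hdrift t) (Finset.sum_le_sum fun t _ => hregret t)
    _ = (τ + 1 / 2) * c * ∑ t ∈ Finset.range N, α t := by
        rw [← Finset.mul_sum, ← Finset.mul_sum, ← Finset.sum_mul]
        ring

section Integral

variable {Ω : Type*} [MeasurableSpace Ω] {μ : Measure Ω} {u v : ℕ → Ω → ℝ}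

theorem integrable_driftRegretCost (α : ℕ → ℝ) (τ N : ℕ) (hu : ∀ t, Integrable (u t) μ)
    (hv : ∀ t, Integrable (v t) μ) :
    Integrable (fun ω => driftRegretCost α τ N (u · ω) (v · ω)) μ :=
  (integrable_finsetSum _ fun t _ => integrable_finsetSum _ fun j _ =>
    (((hu t).add (hv (t + j))).div_const 2).const_mul _).add
    (integrable_finsetSum _ fun t _ => (hv (τ + t)).const_mul _)

theorem integral_driftRegretCost (α : ℕ → ℝ) (τ N : ℕ) (hu : ∀ t, Integrable (u t) μ)
    (hv : ∀ t, Integrable (v t) μ) :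
    ∫ ω, driftRegretCost α τ N (u · ω) (v · ω) ∂μ =
      driftRegretCost α τ N (fun t => ∫ ω, u t ω ∂μ) fun t => ∫ ω, v t ω ∂μ := by
  have hdrift : ∀ t j, Integrable (fun ω => α (t + j) * ((u t ω + v (t + j) ω) / 2)) μ :=
    fun t j => (((hu t).add (hv (t + j))).div_const 2).const_mul _
  have hregret : ∀ t, Integrable (fun ω => α (τ + t) / 2 * v (τ + t) ω) μ :=
    fun t => (hv (τ + t)).const_mul _
  unfold driftRegretCost
  rw [integral_add (integrable_finsetSum _ fun t _ => integrable_finsetSum _ fun j _ => hdrift t j)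
    (integrable_finsetSum _ fun t _ => hregret t), integral_finsetSum _ fun t _ =>
    integrable_finsetSum _ fun j _ => hdrift t j, integral_finsetSum _ fun t _ => hregret t]
  simp_rw [integral_finsetSum _ fun j _ => hdrift _ j, integral_const_mul, integral_div,
    integral_add (hu _) (hv _)]

theorem integral_driftRegretCost_le {α : ℕ → ℝ} (hα : ∀ t, 0 ≤ α t) (hα' : Antitone α) {τ N : ℕ}
    {c : ℝ} (hc : 0 ≤ c) (hu : ∀ t, Integrable (u t) μ) (hv : ∀ t, Integrable (v t) μ)
    (huc : ∀ t, ∫ ω, u t ω ∂μ ≤ c) (hvc : ∀ t, ∫ ω, v t ω ∂μ ≤ c) :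
    ∫ ω, driftRegretCost α τ N (u · ω) (v · ω) ∂μ ≤ (τ + 1 / 2) * c * ∑ t ∈ Finset.range N, α t :=
  (integral_driftRegretCost α τ N hu hv).trans_le (driftRegretCost_le hα hα' hc huc hvc)

end Integral

end MirrorPath

section CondLaw

variable {Ω 𝒲 𝒱 Ξ : Type*} {m mΩ : MeasurableSpace Ω} [MeasurableSpace 𝒲] [MeasurableSpace 𝒱]
  [MeasurableSpace Ξ] {μ : Measure Ω}

/-- The conditional law of `ζ` given the σ-algebra `m` is `K (w ω)`, for an `m`-measurable parameter
`w` of the kernel `K`. -/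
structure HasCondLaw (μ : Measure Ω) (m : MeasurableSpace Ω) (w : Ω → 𝒲) (K : Kernel 𝒲 Ξ)
    (ζ : Ω → Ξ) : Prop where
  measurable_param : Measurable[m] w
  measurable : Measurable[mΩ] ζ
  measure_inter : ∀ B, MeasurableSet[m] B → ∀ A, MeasurableSet A →
    μ (B ∩ ζ ⁻¹' A) = ∫⁻ ω in B, K (w ω) A ∂μ

namespace HasCondLaw

variable [IsFiniteMeasure μ] {w : Ω → 𝒲} {K : Kernel 𝒲 Ξ} [IsMarkovKernel K] {ζ : Ω → Ξ}
  {V : Ω → 𝒱}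

theorem hasCondDistrib (h : HasCondLaw μ m w K ζ) (hm : m ≤ mΩ) (hV : Measurable[m] V) :
    HasCondDistrib ζ (fun ω => (V ω, w ω)) (K.prodMkLeft 𝒱) μ := by
  have hVw : Measurable[m] fun ω => (V ω, w ω) := hV.prodMk h.measurable_param
  have hVw' : Measurable fun ω => (V ω, w ω) := hVw.mono hm le_rfl
  refine ⟨(hVw'.prodMk h.measurable).aemeasurable, Measure.ext_prod fun {S A} hS hA => ?_⟩
  rw [Measure.map_apply (hVw'.prodMk h.measurable) (hS.prod hA),
    Measure.compProd_apply_prod hS hA, setLIntegral_map hS (Kernel.measurable_coe _ hA) hVw']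
  exact h.measure_inter _ (hVw hS) A hA

theorem integrable_compProd (h : HasCondLaw μ m w K ζ) (hm : m ≤ mΩ) (hV : Measurable[m] V)
    {φ : 𝒱 → Ξ → ℝ} (hφ : Measurable (Function.uncurry φ))
    (hint : Integrable (fun ω => φ (V ω) (ζ ω)) μ) :
    Integrable (fun q : (𝒱 × 𝒲) × Ξ => φ q.1.1 q.2)
      (μ.map (fun ω => (V ω, w ω)) ⊗ₘ K.prodMkLeft 𝒱) := by
  have hlaw := h.hasCondDistrib hm hV
  have hφ' : Measurable fun q : (𝒱 × 𝒲) × Ξ => φ q.1.1 q.2 :=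
    hφ.comp (measurable_fst.fst.prodMk measurable_snd)
  rw [← hlaw.map_eq]
  exact (integrable_map_measure hφ'.aestronglyMeasurable hlaw.aemeasurable).2 hint

theorem integrable_integral (h : HasCondLaw μ m w K ζ) (hm : m ≤ mΩ) (hV : Measurable[m] V)
    {φ : 𝒱 → Ξ → ℝ} (hφ : Measurable (Function.uncurry φ))
    (hint : Integrable (fun ω => φ (V ω) (ζ ω)) μ) :
    Integrable (fun ω => ∫ s, φ (V ω) s ∂K (w ω)) μ :=
  (h.integrable_compProd hm hV hφ hint).integral_compProd.comp_aemeasurable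
    (h.hasCondDistrib hm hV).aemeasurable_fst

theorem integral_eq (h : HasCondLaw μ m w K ζ) (hm : m ≤ mΩ) (hV : Measurable[m] V)
    {φ : 𝒱 → Ξ → ℝ} (hφ : Measurable (Function.uncurry φ))
    (hint : Integrable (fun ω => φ (V ω) (ζ ω)) μ) :
    ∫ ω, φ (V ω) (ζ ω) ∂μ = ∫ ω, ∫ s, φ (V ω) s ∂K (w ω) ∂μ := by
  have hlaw := h.hasCondDistrib hm hV
  have hφ' : Measurable fun q : (𝒱 × 𝒲) × Ξ => φ q.1.1 q.2 :=
    hφ.comp (measurable_fst.fst.prodMk measurable_snd)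
  have hmap := hlaw.integral_comp hφ'.aestronglyMeasurable
  rwa [Measure.integral_compProd (h.integrable_compProd hm hV hφ hint),
    integral_map hlaw.aemeasurable_fst
      hφ'.stronglyMeasurable.integral_kernel_prod_right'.aestronglyMeasurable] at hmap

theorem integrable_of_integral_norm_le (h : HasCondLaw μ m w K ζ) (hm : m ≤ mΩ)
    (hV : Measurable[m] V) {φ : 𝒱 → Ξ → ℝ} (hφ : Measurable (Function.uncurry φ))
    (hφV : ∀ ω, Integrable (φ (V ω)) (K (w ω))) {g : Ω → ℝ} (hg : Integrable g μ)
    (hle : ∀ ω, ∫ s, ‖φ (V ω) s‖ ∂K (w ω) ≤ g ω) : Integrable (fun ω => φ (V ω) (ζ ω)) μ := by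
  have hlaw := h.hasCondDistrib hm hV
  have hVw : Measurable fun ω => (V ω, w ω) := (hV.prodMk h.measurable_param).mono hm le_rfl
  have hφ' : Measurable fun q : (𝒱 × 𝒲) × Ξ => φ q.1.1 q.2 :=
    hφ.comp (measurable_fst.fst.prodMk measurable_snd)
  have hsec : MeasurableSet {a : 𝒱 × 𝒲 | Integrable (φ a.1) (K.prodMkLeft 𝒱 a)} :=
    measurableSet_kernel_integrable hφ'.stronglyMeasurable
  have hnorm : Measurable fun a : 𝒱 × 𝒲 => ∫ s, ‖φ a.1 s‖ ∂K.prodMkLeft 𝒱 a :=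
    hφ'.norm.stronglyMeasurable.integral_kernel_prod_right'.measurable
  have hjoint : Integrable (fun q : (𝒱 × 𝒲) × Ξ => φ q.1.1 q.2)
      (μ.map (fun ω => (V ω, w ω)) ⊗ₘ K.prodMkLeft 𝒱) := by
    refine (Measure.integrable_compProd_iff hφ'.aestronglyMeasurable).2
      ⟨(ae_map_iff hVw.aemeasurable hsec).2 (.of_forall hφV),
        (integrable_map_measure hnorm.aestronglyMeasurable hVw.aemeasurable).2 ?_⟩
    exact hg.mono' (hnorm.comp hVw).aestronglyMeasurable (.of_forall fun ω =>
      (Real.norm_of_nonneg (integral_nonneg fun _ => norm_nonneg _)).trans_le (hle ω))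
  rw [← hlaw.map_eq] at hjoint
  exact hjoint.comp_aemeasurable hlaw.aemeasurable

theorem ae_of_forall_ae (h : HasCondLaw μ m w K ζ) (hm : m ≤ mΩ) (hV : Measurable[m] V)
    {p : 𝒱 → Ξ → Prop} (hp : MeasurableSet {q : 𝒱 × Ξ | p q.1 q.2})
    (hae : ∀ ω, ∀ᵐ s ∂K (w ω), p (V ω) s) : ∀ᵐ ω ∂μ, p (V ω) (ζ ω) := by
  have hlaw := h.hasCondDistrib hm hV
  have hp' : MeasurableSet {q : (𝒱 × 𝒲) × Ξ | p q.1.1 q.2} :=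
    hp.preimage (measurable_fst.fst.prodMk measurable_snd)
  have hmeas : MeasurableSet {a : 𝒱 × 𝒲 | ∀ᵐ s ∂K.prodMkLeft 𝒱 a, p a.1 s} :=
    Kernel.measurable_kernel_prodMk_left hp'.compl (measurableSet_singleton 0)
  have hjoint : ∀ᵐ q ∂(μ.map (fun ω => (V ω, w ω)) ⊗ₘ K.prodMkLeft 𝒱), p q.1.1 q.2 := by
    rw [Measure.ae_compProd_iff hp']
    exact (ae_map_iff hlaw.aemeasurable_fst hmeas).2 (.of_forall hae)
  exact (hlaw.ae_iff (measurableSet_setOfPred.1 hp')).2 hjoint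

end HasCondLaw

end CondLaw

section Mixture

variable {Ξ ι : Type*} [MeasurableSpace Ξ] [Fintype ι] {Q : ι → Measure Ξ}

/-- The kernel that draws from the mixture of the measures `Q j` with given weights. -/
noncomputable def mixture (Q : ι → Measure Ξ) : Kernel (stdSimplex ℝ ι) Ξ where
  toFun w := ∑ j, ENNReal.ofReal (w.1 j) • Q j
  measurable' := Measure.measurable_of_measurable_coe _ fun A _ => by
    simp only [Measure.finsetSum_apply, Measure.smul_apply, smul_eq_mul]
    exact Finset.measurable_sum _ fun j _ => Measurable.mul_const
      ((measurable_pi_apply j).comp measurable_subtype_coe).ennreal_ofReal _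

theorem mixture_apply_apply (w : stdSimplex ℝ ι) (A : Set Ξ) :
    mixture Q w A = ∑ j, ENNReal.ofReal (w.1 j) * Q j A := by
  simp [mixture, Measure.finsetSum_apply]

instance isMarkovKernel_mixture [∀ j, IsProbabilityMeasure (Q j)] : IsMarkovKernel (mixture Q) where
  isProbabilityMeasure w := ⟨by
    simp only [mixture_apply_apply, measure_univ, mul_one]
    rw [← ENNReal.ofReal_sum_of_nonneg fun j _ => w.2.1 j, w.2.2, ENNReal.ofReal_one]⟩

theorem ae_mixture {p : Ξ → Prop} (hp : ∀ j, ∀ᵐ s ∂Q j, p s) (w : stdSimplex ℝ ι) :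
    ∀ᵐ s ∂mixture Q w, p s := by
  rw [ae_iff, mixture_apply_apply]
  exact Finset.sum_eq_zero fun j _ => by rw [ae_iff.1 (hp j), mul_zero]

theorem integrable_mixture {φ : Ξ → ℝ} (hφ : ∀ j, Integrable φ (Q j)) (w : stdSimplex ℝ ι) :
    Integrable φ (mixture Q w) :=
  integrable_finsetSum_measure.2 fun j _ => (hφ j).smul_measure ENNReal.ofReal_ne_top

theorem integral_mixture {φ : Ξ → ℝ} (hφ : ∀ j, Integrable φ (Q j)) (w : stdSimplex ℝ ι) :
    ∫ s, φ s ∂mixture Q w = ∑ j, w.1 j * ∫ s, φ s ∂Q j := by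
  calc ∫ s, φ s ∂mixture Q w
    _ = ∑ j, ∫ s, φ s ∂(ENNReal.ofReal (w.1 j) • Q j) :=
      integral_finsetSum_measure fun j _ => (hφ j).smul_measure ENNReal.ofReal_ne_top
    _ = ∑ j, w.1 j * ∫ s, φ s ∂Q j := Finset.sum_congr rfl fun j _ => by
      rw [integral_smul_measure, ENNReal.toReal_ofReal (w.2.1 j), smul_eq_mul]

end Mixture

section Token

variable {Ω Ξ : Type*} [MeasurableSpace Ξ] {n : ℕ} {token : ℕ → Ω → Fin n} {ξ : ℕ → Ω → Ξ}

theorem history_mono : Monotone (history token ξ) := fun _ _ hst =>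
  biSup_mono fun _ hi => ⟨hi.1, hi.2.trans hst⟩

theorem measurable_token_history {s t : ℕ} (hs : s ∈ Set.Icc 1 t) :
    Measurable[history token ξ t] (token s) :=
  .of_comap_le (le_sup_left.trans (le_biSup (fun s => MeasurableSpace.comap (token s) ⊤ ⊔
    MeasurableSpace.comap (ξ s) inferInstance) hs))

theorem measurable_sample_history {s t : ℕ} (hs : s ∈ Set.Icc 1 t) :
    Measurable[history token ξ t] (ξ s) :=
  .of_comap_le (le_sup_right.trans (le_biSup (fun s => MeasurableSpace.comap (token s) ⊤ ⊔
    MeasurableSpace.comap (ξ s) inferInstance) hs))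

variable [mΩ : MeasurableSpace Ω] {μ : Measure Ω} {P : Matrix (Fin n) (Fin n) ℝ}
  {Q : Fin n → Measure Ξ}

/-- The conditional law of the token at time `m + 1` given the history up to time `m`; for `m = 0`
this is the law of the first token. -/
noncomputable def nextTokenLaw (μ : Measure Ω) (P : Matrix (Fin n) (Fin n) ℝ)
    (token : ℕ → Ω → Fin n) : ℕ → Ω → Fin n → ℝ
  | 0, _ => fun j => μ.real {ω | token 1 ω = j}
  | m + 1, ω => P (token (m + 1) ω)

theorem measurable_nextTokenLaw (m : ℕ) :
    Measurable[history token ξ m] (nextTokenLaw μ P token m) := by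
  cases m with
  | zero => exact measurable_const
  | succ m => exact (measurable_of_countable P).comp (measurable_token_history (by simp))

theorem measurable_vecMul_nextTokenLaw (m k : ℕ) :
    Measurable[history token ξ m] fun ω => nextTokenLaw μ P token m ω ᵥ* P ^ k :=
  (continuous_id.matrix_vecMul continuous_const).measurable.comp (measurable_nextTokenLaw m)

theorem vecMul_mem_stdSimplex {ι : Type*} [Fintype ι] [DecidableEq ι] {M : Matrix ι ι ℝ}
    (hM : M ∈ doublyStochastic ℝ ι) {w : ι → ℝ} (hw : w ∈ stdSimplex ℝ ι) :
    w ᵥ* M ∈ stdSimplex ℝ ι := by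
  have hrow := (mem_doublyStochastic_iff_mem_rowStochastic_and_mem_colStochastic.1 hM).1
  refine ⟨Matrix.nonneg_vecMul_of_mem_rowStochastic hrow hw.1, ?_⟩
  simpa [dotProduct, hw.2] using Matrix.vecMul_dotProduct_one_eq_one_rowStochastic hrow
    (x := w) (by simpa [dotProduct] using hw.2)

namespace IsTokenSampling

theorem history_le (h : IsTokenSampling μ P Q token ξ) (t : ℕ) : history token ξ t ≤ mΩ :=
  iSup₂_le fun s _ => sup_le (h.measurable_token s).comap_le (h.measurable_sample s).comap_le

theorem measurableSet_eq_and_mem (h : IsTokenSampling μ P Q token ξ) (t : ℕ) (j : Fin n)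
    {A : Set Ξ} (hA : MeasurableSet A) : MeasurableSet {ω | token t ω = j ∧ ξ t ω ∈ A} :=
  (h.measurable_token t (measurableSet_singleton j)).inter (h.measurable_sample t hA)

theorem measure_inter_preimage_eq_sum (h : IsTokenSampling μ P Q token ξ) (t : ℕ) (B : Set Ω)
    (A : Set Ξ) :
    μ (B ∩ ξ t ⁻¹' A) = ∑ j, μ (B ∩ {ω | token t ω = j ∧ ξ t ω ∈ A}) := by
  have hfiber : ∀ j, MeasurableSet (token t ⁻¹' {j}) :=
    fun j => h.measurable_token t (measurableSet_singleton j)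
  have hsum := sum_measure_preimage_singleton (μ := μ.restrict (B ∩ ξ t ⁻¹' A)) Finset.univ
    fun j _ => hfiber j
  simp only [Finset.coe_univ, Set.preimage_univ, Measure.restrict_apply_univ,
    Measure.restrict_apply (hfiber _)] at hsum
  rw [← hsum]
  refine Finset.sum_congr rfl fun j _ => congrArg μ ?_
  ext ω
  exact and_left_comm

variable [IsProbabilityMeasure μ]

theorem nextTokenLaw_mem_stdSimplex (h : IsTokenSampling μ P Q token ξ)
    (hP : P ∈ doublyStochastic ℝ (Fin n)) (m : ℕ) (ω : Ω) :
    nextTokenLaw μ P token m ω ∈ stdSimplex ℝ (Fin n) := by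
  cases m with
  | zero =>
    refine ⟨fun _ => measureReal_nonneg, ?_⟩
    simpa [nextTokenLaw, Set.preimage] using sum_measureReal_preimage_singleton (μ := μ)
      (f := token 1) Finset.univ fun j _ => h.measurable_token 1 (measurableSet_singleton j)
  | succ m =>
    exact ⟨fun _ => nonneg_of_mem_doublyStochastic hP, sum_row_of_mem_doublyStochastic hP _⟩

theorem vecMul_nextTokenLaw_mem_stdSimplex (h : IsTokenSampling μ P Q token ξ)
    (hP : P ∈ doublyStochastic ℝ (Fin n)) (m k : ℕ) (ω : Ω) :
    nextTokenLaw μ P token m ω ᵥ* P ^ k ∈ stdSimplex ℝ (Fin n) :=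
  vecMul_mem_stdSimplex (pow_mem hP k) (h.nextTokenLaw_mem_stdSimplex hP m ω)

theorem integrable_vecMul_nextTokenLaw (h : IsTokenSampling μ P Q token ξ)
    (hP : P ∈ doublyStochastic ℝ (Fin n)) (m k : ℕ) (j : Fin n) :
    Integrable (fun ω => (nextTokenLaw μ P token m ω ᵥ* P ^ k) j) μ := by
  have hmeas : Measurable fun ω => nextTokenLaw μ P token m ω ᵥ* P ^ k :=
    (measurable_vecMul_nextTokenLaw (ξ := ξ) m k).mono (h.history_le m) le_rfl
  refine .of_mem_Icc 0 1 ((measurable_pi_apply j).comp hmeas).aemeasurable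
    (.of_forall fun ω => ?_)
  exact mem_Icc_of_mem_stdSimplex (h.vecMul_nextTokenLaw_mem_stdSimplex hP m k ω) j

theorem measureReal_inter_succ (h : IsTokenSampling μ P Q token ξ) {m : ℕ} {B : Set Ω}
    (hB : MeasurableSet[history token ξ m] B) (j : Fin n) {A : Set Ξ} (hA : MeasurableSet A) :
    μ.real (B ∩ {ω | token (m + 1) ω = j ∧ ξ (m + 1) ω ∈ A}) =
      (∫ ω in B, nextTokenLaw μ P token m ω j ∂μ) * (Q j).real A := by
  have hS := h.measurableSet_eq_and_mem (m + 1) j hA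
  cases m with
  | zero =>
    have hfirst : μ.real {ω | token 1 ω = j ∧ ξ 1 ω ∈ A} =
        μ.real {ω | token 1 ω = j} * (Q j).real A := by
      simp only [measureReal_def, h.first j A hA, ENNReal.toReal_mul]
    rw [show history token ξ 0 = ⊥ by simp [history],
      MeasurableSpace.measurableSet_bot_iff] at hB
    rcases hB with rfl | rfl
    · simp
    · simpa [nextTokenLaw] using hfirst
  | succ m =>
    have hm := h.history_le (m + 1)
    have hcond := setIntegral_condExp (μ := μ) hm ((integrable_const (1 : ℝ)).indicator hS) hB
    rw [setIntegral_congr_ae (hm _ hB) ((h.step (m + 1) (by simp) j A hA).mono fun _ hω _ => hω),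
      integral_mul_const, integral_indicator_const _ hS, measureReal_restrict_apply hS, smul_eq_mul,
      mul_one, Set.inter_comm] at hcond
    exact hcond.symm

theorem setIntegral_token_succ [∀ j, IsProbabilityMeasure (Q j)]
    (h : IsTokenSampling μ P Q token ξ) {m : ℕ} {B : Set Ω}
    (hB : MeasurableSet[history token ξ m] B) (u : Fin n → ℝ) :
    ∫ ω in B, u (token (m + 1) ω) ∂μ = ∑ l, (∫ ω in B, nextTokenLaw μ P token m ω l ∂μ) * u l := by
  have hc := h.measurable_token (m + 1)
  rw [← integral_map (φ := token (m + 1)) hc.aemeasurable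
    (measurable_of_countable u).aestronglyMeasurable, integral_fintype .of_finite]
  refine Finset.sum_congr rfl fun l _ => ?_
  have hl := h.measureReal_inter_succ hB l .univ
  simp only [Set.mem_univ, and_true, probReal_univ, mul_one] at hl
  rw [← hl, map_measureReal_apply hc (measurableSet_singleton l),
    measureReal_restrict_apply (hc (measurableSet_singleton l)), Set.inter_comm, smul_eq_mul]
  rfl

theorem measureReal_inter_add [∀ j, IsProbabilityMeasure (Q j)]
    (h : IsTokenSampling μ P Q token ξ) (hP : P ∈ doublyStochastic ℝ (Fin n)) {m : ℕ} (k : ℕ)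
    {B : Set Ω} (hB : MeasurableSet[history token ξ m] B) (j : Fin n) {A : Set Ξ}
    (hA : MeasurableSet A) :
    μ.real (B ∩ {ω | token (m + k + 1) ω = j ∧ ξ (m + k + 1) ω ∈ A}) =
      (∫ ω in B, (nextTokenLaw μ P token m ω ᵥ* P ^ k) j ∂μ) * (Q j).real A := by
  induction k generalizing m with
  | zero => simpa using h.measureReal_inter_succ hB j hA
  | succ k ih =>
    have hnext := ih (m := m + 1) (history_mono (Nat.le_succ m) _ hB)
    rw [show m + 1 + k + 1 = m + (k + 1) + 1 by ring] at hnext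
    have hint : ∀ l, Integrable (fun ω => nextTokenLaw μ P token m ω l) (μ.restrict B) :=
        fun l => by
      simpa using (h.integrable_vecMul_nextTokenLaw hP m 0 l).restrict (s := B)
    rw [hnext]
    congr 1
    calc ∫ ω in B, (nextTokenLaw μ P token (m + 1) ω ᵥ* P ^ k) j ∂μ
      _ = ∫ ω in B, (P ^ (k + 1)) (token (m + 1) ω) j ∂μ := by
        simp only [nextTokenLaw, pow_succ', Matrix.mul_apply, Matrix.vecMul, dotProduct]
      _ = ∑ l, (∫ ω in B, nextTokenLaw μ P token m ω l ∂μ) * (P ^ (k + 1)) l j :=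
        h.setIntegral_token_succ hB fun l => (P ^ (k + 1)) l j
      _ = ∫ ω in B, (nextTokenLaw μ P token m ω ᵥ* P ^ (k + 1)) j ∂μ := by
        simp only [Matrix.vecMul, dotProduct]
        rw [integral_finsetSum _ fun l _ => (hint l).mul_const _]
        simp only [integral_mul_const]

theorem hasCondLaw [∀ j, IsProbabilityMeasure (Q j)]
    (h : IsTokenSampling μ P Q token ξ) (hP : P ∈ doublyStochastic ℝ (Fin n)) (m k : ℕ) :
    HasCondLaw μ (history token ξ m)
      (fun ω => ⟨_, h.vecMul_nextTokenLaw_mem_stdSimplex hP m k ω⟩) (mixture Q)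
      (ξ (m + k + 1)) where
  measurable_param := (measurable_vecMul_nextTokenLaw m k).subtype_mk
  measurable := h.measurable_sample _
  measure_inter B hB A hA := by
    have hnonneg := fun ω => (h.vecMul_nextTokenLaw_mem_stdSimplex hP m k ω).1
    have hint := h.integrable_vecMul_nextTokenLaw hP m k
    have hjoint : ∀ j, μ (B ∩ {ω | token (m + k + 1) ω = j ∧ ξ (m + k + 1) ω ∈ A}) =
        (∫⁻ ω in B, ENNReal.ofReal ((nextTokenLaw μ P token m ω ᵥ* P ^ k) j) ∂μ) * Q j A :=
      fun j => by
        rw [← ofReal_integral_eq_lintegral_ofReal (hint j).integrableOn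
          (.of_forall fun ω => hnonneg ω j), ← ofReal_measureReal,
          h.measureReal_inter_add hP k hB j hA,
          ENNReal.ofReal_mul (integral_nonneg fun ω => hnonneg ω j), ofReal_measureReal]
    simp only [mixture_apply_apply]
    rw [h.measure_inter_preimage_eq_sum, lintegral_finsetSum' _ fun j _ =>
      ((hint j).aemeasurable.ennreal_ofReal.mul_const _).restrict]
    refine Finset.sum_congr rfl fun j _ => ?_
    rw [hjoint, lintegral_mul_const'' _ (hint j).aemeasurable.ennreal_ofReal.restrict]

end IsTokenSampling

end Token

section Concentration

variable {Ω : Type*} {m mΩ : MeasurableSpace Ω} {μ : Measure Ω}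

/-- `Z` is sub-Gaussian with parameter `K` conditionally on the σ-algebra `m`: adding `Z` to a
sub-Gaussian `m`-measurable variable increases its parameter by at most `K`.  Unlike Mathlib's
`HasCondSubgaussianMGF`, this notion does not need a standard Borel space. -/
def IsSubgaussianIncrement (μ : Measure Ω) (m : MeasurableSpace Ω) (Z : Ω → ℝ) (K : ℝ≥0) : Prop :=
  ∀ ⦃S : Ω → ℝ⦄ ⦃c : ℝ≥0⦄, Measurable[m] S → HasSubgaussianMGF S c μ →
    HasSubgaussianMGF (fun ω => S ω + Z ω) (c + K) μ

section Increment

variable {𝒲 𝒱 Ξ : Type*} [MeasurableSpace 𝒲] [MeasurableSpace 𝒱] [MeasurableSpace Ξ] {w : Ω → 𝒲}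
  {κ : Kernel 𝒲 Ξ} [IsMarkovKernel κ] {ζ : Ω → Ξ} {V : Ω → 𝒱} {φ : 𝒱 → Ξ → ℝ}

theorem HasCondLaw.isSubgaussianIncrement [IsFiniteMeasure μ] (h : HasCondLaw μ m w κ ζ)
    (hm : m ≤ mΩ) (hV : Measurable[m] V) (hφ : Measurable (Function.uncurry φ)) {K : ℝ≥0}
    (hsub : ∀ ω, HasSubgaussianMGF (φ (V ω)) K (κ (w ω))) :
    IsSubgaussianIncrement μ m (fun ω => φ (V ω) (ζ ω)) K := by
  intro S c hS hSc
  have hVS : Measurable[m] fun ω => (V ω, S ω) := hV.prodMk hS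
  have hexp : ∀ t, Measurable (Function.uncurry fun (q : 𝒱 × ℝ) (s : Ξ) =>
      Real.exp (t * (q.2 + φ q.1 s))) := fun t => by
    have := hφ.comp (measurable_fst.fst.prodMk measurable_snd :
      Measurable fun q : (𝒱 × ℝ) × Ξ => (q.1.1, q.2))
    exact Real.measurable_exp.comp ((measurable_fst.snd.add this).const_mul t)
  have hfactor : ∀ t ω s, Real.exp (t * (S ω + φ (V ω) s)) =
      Real.exp (t * S ω) * Real.exp (t * φ (V ω) s) := fun t ω s => by
    rw [mul_add, Real.exp_add]
  have hcond : ∀ t ω, ∫ s, Real.exp (t * (S ω + φ (V ω) s)) ∂κ (w ω) ≤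
      Real.exp (t * S ω) * Real.exp (K * t ^ 2 / 2) := fun t ω => by
    simp only [hfactor, integral_const_mul]
    exact mul_le_mul_of_nonneg_left ((hsub ω).mgf_le t) (Real.exp_nonneg _)
  have hdom : ∀ t, Integrable (fun ω => Real.exp (t * S ω) * Real.exp (K * t ^ 2 / 2)) μ :=
    fun t => (hSc.integrable_exp_mul t).mul_const _
  have hint : ∀ t, Integrable (fun ω => Real.exp (t * (S ω + φ (V ω) (ζ ω)))) μ := fun t => by
    refine h.integrable_of_integral_norm_le hm hVS (hexp t) (fun ω => ?_) (hdom t) fun ω => ?_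
    · simpa only [hfactor] using ((hsub ω).integrable_exp_mul t).const_mul _
    · simpa only [Real.norm_eq_abs, Real.abs_exp] using hcond t ω
  refine ⟨hint, fun t => ?_⟩
  calc mgf (fun ω => S ω + φ (V ω) (ζ ω)) μ t
    _ = ∫ ω, ∫ s, Real.exp (t * (S ω + φ (V ω) s)) ∂κ (w ω) ∂μ :=
      h.integral_eq hm hVS (hexp t) (hint t)
    _ ≤ ∫ ω, Real.exp (t * S ω) * Real.exp (K * t ^ 2 / 2) ∂μ :=
      integral_mono_of_nonneg (.of_forall fun _ => integral_nonneg fun _ => Real.exp_nonneg _)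
        (hdom t) (.of_forall (hcond t))
    _ = mgf S μ t * Real.exp (K * t ^ 2 / 2) := integral_mul_const _ _
    _ ≤ Real.exp (c * t ^ 2 / 2) * Real.exp (K * t ^ 2 / 2) := by
      gcongr
      exact hSc.mgf_le t
    _ = Real.exp (((c + K : ℝ≥0) : ℝ) * t ^ 2 / 2) := by
      rw [← Real.exp_add, NNReal.coe_add]
      ring_nf

theorem measurable_sub_integral_kernel (hφ : Measurable (Function.uncurry φ)) :
    Measurable (Function.uncurry fun (q : 𝒱 × 𝒲) s => φ q.1 s - ∫ s, φ q.1 s ∂κ q.2) := by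
  have hφ' : Measurable fun q : (𝒱 × 𝒲) × Ξ => φ q.1.1 q.2 :=
    hφ.comp (measurable_fst.fst.prodMk measurable_snd)
  exact hφ'.sub ((hφ'.stronglyMeasurable.integral_kernel_prod_right'
    (κ := κ.prodMkLeft 𝒱)).measurable.comp measurable_fst)

theorem HasCondLaw.isSubgaussianIncrement_sub_integral [IsFiniteMeasure μ]
    (h : HasCondLaw μ m w κ ζ) (hm : m ≤ mΩ) (hV : Measurable[m] V)
    (hφ : Measurable (Function.uncurry φ)) {c : Ω → ℝ} {K : ℝ≥0}
    (hc : ∀ ω, ∀ᵐ s ∂κ (w ω), |φ (V ω) s - c ω| ≤ K) :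
    IsSubgaussianIncrement μ m (fun ω => φ (V ω) (ζ ω) - ∫ s, φ (V ω) s ∂κ (w ω)) (K ^ 2) := by
  refine h.isSubgaussianIncrement (V := fun ω => (V ω, w ω)) hm (hV.prodMk h.measurable_param)
    (measurable_sub_integral_kernel (κ := κ) hφ) fun ω => ?_
  have hIcc : ∀ᵐ s ∂κ (w ω), φ (V ω) s ∈ Set.Icc (c ω - K) (c ω + K) :=
    (hc ω).mono fun s hs => Set.mem_Icc_iff_abs_le.1 (by rwa [abs_sub_comm])
  have hwidth : (‖c ω + K - (c ω - K)‖₊ / 2) ^ 2 = K ^ 2 := by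
    rw [show c ω + K - (c ω - K) = 2 * K by ring]
    simp
  simpa only [hwidth] using hasSubgaussianMGF_of_mem_Icc
    (hφ.of_uncurry_left (x := V ω)).aemeasurable hIcc

end Increment

theorem hasSubgaussianMGF_mono {X : Ω → ℝ} {c d : ℝ≥0} (hX : HasSubgaussianMGF X c μ)
    (hcd : c ≤ d) : HasSubgaussianMGF X d μ where
  integrable_exp_mul := hX.integrable_exp_mul
  mgf_le t := (hX.mgf_le t).trans (by gcongr)

variable [IsProbabilityMeasure μ]

theorem hasSubgaussianMGF_sum {ι : Type*} (s : Finset ι) {X : ι → Ω → ℝ} {c : ι → ℝ≥0}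
    (hX : ∀ i ∈ s, HasSubgaussianMGF (X i) (c i) μ) :
    HasSubgaussianMGF (fun ω => ∑ i ∈ s, X i ω) (s.card * ∑ i ∈ s, c i) μ := by
  classical
  have hsqrt : HasSubgaussianMGF (fun ω => ∑ i ∈ s, X i ω) ((∑ i ∈ s, (c i).sqrt) ^ 2) μ := by
    induction s using Finset.induction_on with
    | empty => simp
    | insert i s hi ih =>
      simp only [Finset.sum_insert hi]
      simpa using (hX i (Finset.mem_insert_self i s)).add
        (ih fun j hj => hX j (Finset.mem_insert_of_mem hj))
  refine hasSubgaussianMGF_mono hsqrt ?_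
  simpa using sq_sum_le_card_mul_sum_sq (s := s) (f := fun i => (c i).sqrt)

variable {ℋ : ℕ → MeasurableSpace Ω} {Z : ℕ → Ω → ℝ} {M : ℕ} {K : ℝ≥0}

theorem hasSubgaussianMGF_sum_residueClass (hℋ : Monotone ℋ)
    (hZ : ∀ t, Measurable[ℋ (t + M)] (Z t))
    (hinc : ∀ t, IsSubgaussianIncrement μ (ℋ t) (Z t) K) (r N : ℕ) :
    HasSubgaussianMGF (fun ω => ∑ t ∈ Finset.range N with t % M = r, Z t ω)
      ({t ∈ Finset.range N | t % M = r}.card * K) μ := by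
  induction N with
  | zero => simp
  | succ N ih =>
    by_cases hr : N % M = r
    · have hpast : Measurable[ℋ N] fun ω => ∑ t ∈ Finset.range N with t % M = r, Z t ω := by
        refine Finset.measurable_fun_sum _ fun t ht => (hZ t).mono (hℋ ?_) le_rfl
        obtain ⟨htN, htr⟩ := Finset.mem_filter.1 ht
        exact Nat.ModEq.add_le_of_lt (htr.trans hr.symm) (Finset.mem_range.1 htN)
      have hN := hinc N hpast ih
      simpa [Finset.range_add_one, Finset.filter_insert, hr, add_comm, add_mul] using hN
    · simpa [Finset.range_add_one, Finset.filter_insert, hr] using ih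

/-- Azuma–Hoeffding for increments that are revealed with delay `M`: the sum splits into `M`
interleaved sums over residue classes, each of which is a sum of conditionally sub-Gaussian
increments. -/
theorem measureReal_sum_range_ge_le (hℋ : Monotone ℋ) (hM : 0 < M)
    (hZ : ∀ t, Measurable[ℋ (t + M)] (Z t))
    (hinc : ∀ t, IsSubgaussianIncrement μ (ℋ t) (Z t) K) (N : ℕ) {γ : ℝ} (hγ : 0 ≤ γ) :
    μ.real {ω | γ ≤ ∑ t ∈ Finset.range N, Z t ω} ≤ Real.exp (-γ ^ 2 / (2 * (M * (N * K)))) := by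
  have hmod : ∀ t ∈ Finset.range N, t % M ∈ Finset.range M :=
    fun t _ => Finset.mem_range.2 (Nat.mod_lt t hM)
  have hcard : ∑ r ∈ Finset.range M, ({t ∈ Finset.range N | t % M = r}.card * K : ℝ≥0) = N * K := by
    rw [← Finset.sum_mul, ← Nat.cast_sum, ← Finset.card_eq_sum_card_fiberwise hmod,
      Finset.card_range]
  have hsum := hasSubgaussianMGF_sum (Finset.range M) fun r _ =>
    hasSubgaussianMGF_sum_residueClass hℋ hZ hinc r N
  simp only [Finset.sum_fiberwise_of_maps_to hmod, hcard, Finset.card_range] at hsum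
  simpa using hsum.measure_ge_le hγ

end Concentration

section SecondMoment

variable {Ξ V : Type*} [MeasurableSpace Ξ] [NormedAddCommGroup V] {ν : Measure Ξ} {g : Ξ → V}
  {L : ℝ}

/-- The second moment of `g` under `ν` exists and is at most `L ^ 2`. -/
def HasSecondMomentLE (ν : Measure Ξ) (g : Ξ → V) (L : ℝ) : Prop :=
  Integrable (fun s => ‖g s‖ ^ 2) ν ∧ ∫ s, ‖g s‖ ^ 2 ∂ν ≤ L ^ 2

theorem hasSecondMomentLE_of_ae_norm_le [IsProbabilityMeasure ν]
    (hg : AEStronglyMeasurable (fun s => ‖g s‖) ν) (hL : ∀ᵐ s ∂ν, ‖g s‖ ≤ L) :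
    HasSecondMomentLE ν g L := by
  have hsq : ∀ᵐ s ∂ν, ‖g s‖ ^ 2 ≤ L ^ 2 := hL.mono fun s hs => by gcongr
  have hint : Integrable (fun s => ‖g s‖ ^ 2) ν := (integrable_const (L ^ 2)).mono' (hg.pow 2)
    (hsq.mono fun s hs => by rwa [Real.norm_of_nonneg (by positivity)])
  exact ⟨hint, by simpa using integral_mono_ae hint (integrable_const _) hsq⟩

theorem HasSecondMomentLE.integrable_norm [IsFiniteMeasure ν] (h : HasSecondMomentLE ν g L) :
    Integrable (fun s => ‖g s‖) ν := by
  have hmeas : AEStronglyMeasurable (fun s => ‖g s‖) ν := by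
    simpa only [Function.comp_def, Real.sqrt_sq (norm_nonneg _)] using
      Real.continuous_sqrt.comp_aestronglyMeasurable h.1.aestronglyMeasurable
  refine (h.1.add (integrable_const 1)).mono' hmeas (.of_forall fun s => ?_)
  rw [norm_norm, Pi.add_apply]
  linarith [two_mul_le_add_sq ‖g s‖ 1, sq_nonneg (‖g s‖ - 1), norm_nonneg (g s)]

theorem HasSecondMomentLE.integral_norm_le [IsProbabilityMeasure ν] (h : HasSecondMomentLE ν g L)
    (hL : 0 < L) : ∫ s, ‖g s‖ ∂ν ≤ L := by
  have hamgm : ∫ s, 2 * L * ‖g s‖ ∂ν ≤ ∫ s, (‖g s‖ ^ 2 + L ^ 2) ∂ν :=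
    integral_mono (h.integrable_norm.const_mul _) (h.1.add (integrable_const _)) fun s => by
      dsimp only
      linarith [two_mul_le_add_sq ‖g s‖ L]
  rw [integral_const_mul, integral_add h.1 (integrable_const _), integral_const, probReal_univ,
    one_smul] at hamgm
  nlinarith [h.2]

theorem HasSecondMomentLE.mixture {ι : Type*} [Fintype ι] {Q : ι → Measure Ξ}
    (h : ∀ j, HasSecondMomentLE (Q j) g L) (w : stdSimplex ℝ ι) :
    HasSecondMomentLE (mixture Q w) g L := by
  refine ⟨integrable_mixture (fun j => (h j).1) w, ?_⟩
  rw [integral_mixture fun j => (h j).1]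
  calc ∑ j, w.1 j * ∫ s, ‖g s‖ ^ 2 ∂Q j
    _ ≤ ∑ j, w.1 j * L ^ 2 :=
      Finset.sum_le_sum fun j _ => mul_le_mul_of_nonneg_left (h j).2 (w.2.1 j)
    _ = L ^ 2 := by rw [← Finset.sum_mul, w.2.2, one_mul]

theorem HasCondLaw.hasSecondMomentLE [MeasurableSpace V] [OpensMeasurableSpace V] {Ω 𝒲 𝒱 : Type*}
    {m mΩ : MeasurableSpace Ω} [MeasurableSpace 𝒲] [MeasurableSpace 𝒱] {μ : Measure Ω}
    [IsProbabilityMeasure μ] {w : Ω → 𝒲} {K : Kernel 𝒲 Ξ} [IsMarkovKernel K] {ζ : Ω → Ξ}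
    (h : HasCondLaw μ m w K ζ) (hm : m ≤ mΩ) {Y : Ω → 𝒱} (hY : Measurable[m] Y) {Γ : 𝒱 → Ξ → V}
    (hΓ : Measurable (Function.uncurry Γ)) (hL : ∀ ω, HasSecondMomentLE (K (w ω)) (Γ (Y ω)) L) :
    HasSecondMomentLE μ (fun ω => Γ (Y ω) (ζ ω)) L := by
  have hsq : Measurable (Function.uncurry fun y s => ‖Γ y s‖ ^ 2) := hΓ.norm.pow_const 2
  have hconst : Integrable (fun _ : Ω => L ^ 2) μ := integrable_const _
  have hint : Integrable (fun ω => ‖Γ (Y ω) (ζ ω)‖ ^ 2) μ :=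
    h.integrable_of_integral_norm_le hm hY hsq (fun ω => (hL ω).1) hconst fun ω => by
      simpa only [norm_pow, norm_norm] using (hL ω).2
  refine ⟨hint, (h.integral_eq hm hY hsq hint).trans_le ?_⟩
  simpa using integral_mono_of_nonneg (.of_forall fun ω => integral_nonneg fun _ => sq_nonneg _)
    hconst (.of_forall fun ω => (hL ω).2)

end SecondMoment

section AverageIterate

theorem averageIterate_eq_sum {E Ω : Type*} [NormedAddCommGroup E] [NormedSpace ℝ E]
    (x : ℕ → Ω → E) (T : ℕ) (ω : Ω) :
    averageIterate x T ω = ∑ t ∈ Finset.range T, (1 / (T : ℝ)) • x (t + 1) ω := by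
  rw [averageIterate, Finset.smul_sum, Finset.range_eq_Ico,
    Finset.sum_Ico_add' (fun t => (1 / (T : ℝ)) • x t ω)]
  rfl

variable {E Ω : Type*} [NormedAddCommGroup E] [NormedSpace ℝ E] {X : Set E} {x : ℕ → Ω → E} {ω : Ω}
  {T : ℕ}

theorem averageIterate_mem (hX : Convex ℝ X) (hx : ∀ t, x (t + 1) ω ∈ X) (hT : 1 ≤ T) :
    averageIterate x T ω ∈ X := by
  rw [averageIterate_eq_sum]
  exact hX.sum_mem (fun _ _ => by positivity) (by simp [show T ≠ 0 by lia]) fun t _ => hx t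

theorem apply_averageIterate_sub_le {f : E → ℝ} (hf : ConvexOn ℝ X f) (hx : ∀ t, x (t + 1) ω ∈ X)
    (hT : 1 ≤ T) (z : E) :
    f (averageIterate x T ω) - f z ≤ (∑ t ∈ Finset.range T, (f (x (t + 1) ω) - f z)) / T := by
  have hT' : (T : ℝ) ≠ 0 := by positivity
  have hjensen := hf.map_sum_le (t := Finset.range T) (w := fun _ => 1 / (T : ℝ))
    (p := fun t => x (t + 1) ω) (fun _ _ => by positivity) (by simp [hT']) fun t _ => hx t
  rw [← averageIterate_eq_sum] at hjensen
  calc f (averageIterate x T ω) - f z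
    _ ≤ ∑ t ∈ Finset.range T, (1 / (T : ℝ)) • f (x (t + 1) ω) - f z := by gcongr
    _ = (∑ t ∈ Finset.range T, (f (x (t + 1) ω) - f z)) / T := by
      rw [Finset.sum_sub_distrib, ← Finset.smul_sum, smul_eq_mul]
      simp
      field_simp

theorem integral_apply_averageIterate_sub_le [MeasurableSpace Ω] {μ : Measure Ω}
    [IsProbabilityMeasure μ] {f : E → ℝ} (hf : ConvexOn ℝ X f) (hx : ∀ t ω, x (t + 1) ω ∈ X)
    (hT : 1 ≤ T) (havg : Integrable (fun ω => f (averageIterate x T ω)) μ)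
    (hint : ∀ t, Integrable (fun ω => f (x (t + 1) ω)) μ) (z : E) :
    ∫ ω, f (averageIterate x T ω) ∂μ - f z ≤
      (∫ ω, ∑ t ∈ Finset.range T, (f (x (t + 1) ω) - f z) ∂μ) / T := by
  calc ∫ ω, f (averageIterate x T ω) ∂μ - f z
    _ = ∫ ω, (f (averageIterate x T ω) - f z) ∂μ := by
      rw [integral_sub havg (integrable_const _), integral_const, probReal_univ, one_smul]
    _ ≤ ∫ ω, (∑ t ∈ Finset.range T, (f (x (t + 1) ω) - f z)) / T ∂μ :=
      integral_mono (havg.sub (integrable_const _)) ((integrable_finsetSum _ fun t _ =>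
        (hint t).sub (integrable_const _)).div_const _) fun ω =>
          apply_averageIterate_sub_le hf (hx · ω) hT z
    _ = (∫ ω, ∑ t ∈ Finset.range T, (f (x (t + 1) ω) - f z) ∂μ) / T := integral_div _ _

end AverageIterate

section Objective

variable {E Ξ : Type*} [MeasurableSpace Ξ] {n : ℕ} {Q : Fin n → Measure Ξ} {F : E → Ξ → ℝ}

theorem objective_sub_objective (y z : E) : objective Q F y - objective Q F z =
    ∑ i, (1 / (n : ℝ)) * (∫ s, F y s ∂Q i - ∫ s, F z s ∂Q i) := by
  rw [objective, objective, ← mul_sub, ← Finset.sum_sub_distrib, Finset.mul_sum]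

theorem abs_objective_sub_le_of_forall (hn : n ≠ 0) {C : ℝ} {y z : E}
    (hC : ∀ i, |∫ s, F y s ∂Q i - ∫ s, F z s ∂Q i| ≤ C) :
    |objective Q F y - objective Q F z| ≤ C := by
  rw [objective_sub_objective]
  calc |∑ i, (1 / (n : ℝ)) * (∫ s, F y s ∂Q i - ∫ s, F z s ∂Q i)|
    _ ≤ ∑ i, |(1 / (n : ℝ)) * (∫ s, F y s ∂Q i - ∫ s, F z s ∂Q i)| :=
      Finset.abs_sum_le_sum_abs _ _
    _ ≤ ∑ _i : Fin n, (1 / (n : ℝ)) * C := Finset.sum_le_sum fun i _ => by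
      rw [abs_mul, abs_of_nonneg (by positivity)]
      exact mul_le_mul_of_nonneg_left (hC i) (by positivity)
    _ = C := by
      simp
      field_simp

end Objective

section Loss

variable {E : Type*} [NormedAddCommGroup E] [NormedSpace ℝ E] [MeasurableSpace E]
  {Ξ : Type*} [MeasurableSpace Ξ] {n : ℕ} {X : Set E} {Q : Fin n → Measure Ξ}
  {F : E → Ξ → ℝ} {G : E → Ξ → StrongDual ℝ E} {R L : ℝ}

/-- The error of the sampled decrease of the loss from `y` to `z` as an estimate of the decrease of
the objective. -/
noncomputable def samplingError (Q : Fin n → Measure Ξ) (F : E → Ξ → ℝ) (z y : E) (s : Ξ) : ℝ :=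
  F z s - F y s + (objective Q F y - objective Q F z)

namespace IsLossFamily

theorem convexOn_objective (hF : IsLossFamily X Q F G) (hX : Convex ℝ X) :
    ConvexOn ℝ X (objective Q F) := by
  refine ⟨hX, fun y hy z hz a b ha hb hab => ?_⟩
  rw [smul_eq_mul, smul_eq_mul, objective, objective, objective, mul_left_comm a, mul_left_comm b,
    ← mul_add]
  refine mul_le_mul_of_nonneg_left ?_ (by positivity)
  rw [Finset.mul_sum, Finset.mul_sum, ← Finset.sum_add_distrib]
  refine Finset.sum_le_sum fun i _ => ?_
  have hy' := (hF.integrable i y hy).const_mul a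
  have hz' := (hF.integrable i z hz).const_mul b
  rw [← integral_const_mul, ← integral_const_mul, ← integral_add hy' hz']
  exact integral_mono (hF.integrable i _ (hX hy hz ha hb hab)) (hy'.add hz')
    fun s => (hF.convexOn s).2 hy hz ha hb hab

theorem sub_le (hF : IsLossFamily X Q F G) (s : Ξ) {y z : E} (hy : y ∈ X) (hz : z ∈ X)
    (hyz : ‖y - z‖ ≤ R) : F y s - F z s ≤ R * ‖G y s‖ := by
  have hsub : F y s + G y s (z - y) ≤ F z s := hF.subgradient s y hy z hz
  have hdual : -G y s (z - y) ≤ ‖G y s‖ * ‖y - z‖ := by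
    rw [norm_sub_rev]
    exact (neg_le_abs _).trans ((G y s).le_opNorm _)
  linarith [mul_le_mul_of_nonneg_left hyz (norm_nonneg (G y s))]

theorem abs_sub_le (hF : IsLossFamily X Q F G) (s : Ξ) {y z : E} (hy : y ∈ X) (hz : z ∈ X)
    (hyz : ‖y - z‖ ≤ R) : |F z s - F y s| ≤ R * max ‖G y s‖ ‖G z s‖ := by
  have hR : 0 ≤ R := (norm_nonneg _).trans hyz
  refine abs_sub_le_iff.2
    ⟨(hF.sub_le s hz hy (norm_sub_rev y z ▸ hyz)).trans ?_, (hF.sub_le s hy hz hyz).trans ?_⟩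
  exacts [mul_le_mul_of_nonneg_left (le_max_right _ _) hR,
    mul_le_mul_of_nonneg_left (le_max_left _ _) hR]

theorem measurable_objective [∀ i, IsProbabilityMeasure (Q i)] (hF : IsLossFamily X Q F G) :
    Measurable (objective Q F) :=
  (Finset.measurable_fun_sum _ fun i _ =>
    (hF.measurable_loss.stronglyMeasurable.integral_prod_right (ν := Q i)).measurable).const_mul _

theorem measurable_samplingError [∀ i, IsProbabilityMeasure (Q i)] (hF : IsLossFamily X Q F G)
    (z : E) : Measurable (Function.uncurry (samplingError Q F z)) := by
  have hobj := hF.measurable_objective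
  exact ((hF.measurable_loss.comp (measurable_const.prodMk measurable_snd)).sub
    hF.measurable_loss).add ((hobj.comp measurable_fst).sub_const _)

theorem integral_sub_le {ν : Measure Ξ} [IsProbabilityMeasure ν] (hF : IsLossFamily X Q F G)
    (hL : 0 < L) {y z : E} (hy : y ∈ X) (hz : z ∈ X) (hyz : ‖y - z‖ ≤ R)
    (hFy : Integrable (F y) ν) (hFz : Integrable (F z) ν) (hG : HasSecondMomentLE ν (G y) L) :
    ∫ s, F y s ∂ν - ∫ s, F z s ∂ν ≤ R * L := by
  rw [← integral_sub hFy hFz]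
  calc ∫ s, (F y s - F z s) ∂ν
    _ ≤ ∫ s, R * ‖G y s‖ ∂ν := integral_mono (hFy.sub hFz) (hG.integrable_norm.const_mul R)
      fun s => hF.sub_le s hy hz hyz
    _ = R * ∫ s, ‖G y s‖ ∂ν := integral_const_mul _ _
    _ ≤ R * L := mul_le_mul_of_nonneg_left (hG.integral_norm_le hL) ((norm_nonneg _).trans hyz)

variable [∀ i, IsProbabilityMeasure (Q i)]

theorem abs_integral_sub_le (hF : IsLossFamily X Q F G) (hL : 0 < L)
    (hdiam : ∀ y ∈ X, ∀ z ∈ X, ‖y - z‖ ≤ R) (hG : ∀ i, ∀ y ∈ X, HasSecondMomentLE (Q i) (G y) L)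
    (i : Fin n) {y z : E} (hy : y ∈ X) (hz : z ∈ X) :
    |∫ s, F y s ∂Q i - ∫ s, F z s ∂Q i| ≤ R * L := by
  have hone : ∀ {y z}, y ∈ X → z ∈ X → ∫ s, F y s ∂Q i - ∫ s, F z s ∂Q i ≤ R * L :=
    fun {y z} hy hz => hF.integral_sub_le hL hy hz (hdiam y hy z hz) (hF.integrable i y hy)
      (hF.integrable i z hz) (hG i y hy)
  exact abs_sub_le_iff.2 ⟨hone hy hz, hone hz hy⟩

theorem abs_objective_sub_le (hF : IsLossFamily X Q F G) (hn : n ≠ 0) (hL : 0 < L)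
    (hdiam : ∀ y ∈ X, ∀ z ∈ X, ‖y - z‖ ≤ R) (hG : ∀ i, ∀ y ∈ X, HasSecondMomentLE (Q i) (G y) L)
    {y z : E} (hy : y ∈ X) (hz : z ∈ X) : |objective Q F y - objective Q F z| ≤ R * L :=
  abs_objective_sub_le_of_forall hn fun i => hF.abs_integral_sub_le hL hdiam hG i hy hz

end IsLossFamily

theorem IsLossFamily.integral_samplingError_le [∀ i, IsProbabilityMeasure (Q i)]
    (hF : IsLossFamily X Q F G) {C ε : ℝ} (hC0 : 0 ≤ C) {y z : E} (hy : y ∈ X) (hz : z ∈ X)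
    (hC : ∀ i, |∫ s, F z s ∂Q i - ∫ s, F y s ∂Q i| ≤ C) {w : stdSimplex ℝ (Fin n)}
    (hw : ∑ j, |w.1 j - 1 / (n : ℝ)| ≤ ε) :
    ∫ s, samplingError Q F z y s ∂mixture Q w ≤ ε * C := by
  have hsub : ∀ i, Integrable (fun s => F z s - F y s) (Q i) := fun i =>
    (hF.integrable i z hz).sub (hF.integrable i y hy)
  calc ∫ s, samplingError Q F z y s ∂mixture Q w
    _ = ∫ s, (F z s - F y s) ∂mixture Q w + (objective Q F y - objective Q F z) := by
      simp only [samplingError]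
      rw [integral_add (integrable_mixture hsub w) (integrable_const _), integral_const,
        probReal_univ, one_smul]
    _ = ∑ j, (w.1 j - 1 / (n : ℝ)) * (∫ s, F z s ∂Q j - ∫ s, F y s ∂Q j) := by
      rw [integral_mixture hsub, objective_sub_objective, ← Finset.sum_add_distrib]
      refine Finset.sum_congr rfl fun j _ => ?_
      rw [integral_sub (hF.integrable j z hz) (hF.integrable j y hy)]
      ring
    _ ≤ ∑ j, |w.1 j - 1 / (n : ℝ)| * C := Finset.sum_le_sum fun j _ =>
      (le_abs_self _).trans ((abs_mul _ _).trans_le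
        (mul_le_mul_of_nonneg_left (hC j) (abs_nonneg _)))
    _ ≤ ε * C := by
      rw [← Finset.sum_mul]
      exact mul_le_mul_of_nonneg_right hw hC0

end Loss

section Sampling

variable {E : Type*} [NormedAddCommGroup E] [NormedSpace ℝ E] [MeasurableSpace E]
  {Ξ : Type*} [MeasurableSpace Ξ] {n : ℕ} {X : Set E} {Q : Fin n → Measure Ξ}
  {F : E → Ξ → ℝ} {G : E → Ξ → StrongDual ℝ E} {R L : ℝ}
  {Ω : Type*} {m mΩ : MeasurableSpace Ω} {μ : Measure Ω} [IsProbabilityMeasure μ]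
  {w : Ω → stdSimplex ℝ (Fin n)} {ζ : Ω → Ξ} {Y : Ω → E} {z : E}

namespace IsLossFamily

theorem abs_samplingError_sub_le (hF : IsLossFamily X Q F G) (hR : 0 ≤ R)
    (hdiam : ∀ y ∈ X, ∀ z ∈ X, ‖y - z‖ ≤ R) {y : E} (hy : y ∈ X) (hz : z ∈ X) {s : Ξ}
    (hys : ‖G y s‖ ≤ L) (hzs : ‖G z s‖ ≤ L) :
    |samplingError Q F z y s - (objective Q F y - objective Q F z)| ≤ R * L := by
  rw [samplingError, add_sub_cancel_right]
  exact (hF.abs_sub_le s hy hz (hdiam y hy z hz)).trans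
    (mul_le_mul_of_nonneg_left (max_le hys hzs) hR)

variable [∀ i, IsProbabilityMeasure (Q i)]

theorem integrable_samplingError (hF : IsLossFamily X Q F G) (hL : 0 < L)
    (hdiam : ∀ y ∈ X, ∀ z ∈ X, ‖y - z‖ ≤ R) (hG : ∀ i, ∀ y ∈ X, HasSecondMomentLE (Q i) (G y) L)
    (hn : n ≠ 0) (hζ : HasCondLaw μ m w (mixture Q) ζ) (hm : m ≤ mΩ) (hY : Measurable[m] Y)
    (hYX : ∀ ω, Y ω ∈ X) (hz : z ∈ X) :
    Integrable (fun ω => samplingError Q F z (Y ω) (ζ ω)) μ := by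
  have hmeas : Measurable fun ω => samplingError Q F z (Y ω) (ζ ω) :=
    (hF.measurable_samplingError z).comp ((hY.mono hm le_rfl).prodMk hζ.measurable)
  have hnorm : ∀ {Y' : Ω → E}, Measurable[m] Y' → (∀ ω, Y' ω ∈ X) →
      Integrable (fun ω => ‖G (Y' ω) (ζ ω)‖) μ := fun hY' hY'X =>
    (hζ.hasSecondMomentLE hm hY' hF.measurable_subgradient
      fun ω => .mixture (fun i => hG i _ (hY'X ω)) _).integrable_norm
  have hmax := (hnorm hY hYX).sup (hnorm measurable_const fun _ => hz)
  refine ((hmax.const_mul R).add (integrable_const (R * L))).mono' hmeas.aestronglyMeasurable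
    (.of_forall fun ω => ?_)
  exact (abs_add_le _ _).trans (add_le_add (hF.abs_sub_le _ (hYX ω) hz (hdiam _ (hYX ω) z hz))
    (hF.abs_objective_sub_le hn hL hdiam hG (hYX ω) hz))

theorem integral_samplingError_comp_le (hF : IsLossFamily X Q F G) (hL : 0 < L)
    (hdiam : ∀ y ∈ X, ∀ z ∈ X, ‖y - z‖ ≤ R) (hG : ∀ i, ∀ y ∈ X, HasSecondMomentLE (Q i) (G y) L)
    (hn : n ≠ 0) (hζ : HasCondLaw μ m w (mixture Q) ζ) (hm : m ≤ mΩ) (hY : Measurable[m] Y)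
    (hYX : ∀ ω, Y ω ∈ X) (hz : z ∈ X) {ε : ℝ} (hw : ∀ ω, ∑ j, |(w ω).1 j - 1 / (n : ℝ)| ≤ ε) :
    ∫ ω, samplingError Q F z (Y ω) (ζ ω) ∂μ ≤ ε * (R * L) := by
  have hR : 0 ≤ R := (norm_nonneg _).trans (hdiam z hz z hz)
  have hmeas := hF.measurable_samplingError z
  have hint := hF.integrable_samplingError hL hdiam hG hn hζ hm hY hYX hz
  rw [hζ.integral_eq hm hY hmeas hint]
  have hle := integral_mono (hζ.integrable_integral hm hY hmeas hint)
    (integrable_const (ε * (R * L))) fun ω => hF.integral_samplingError_le (mul_nonneg hR hL.le)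
      (hYX ω) hz (fun i => hF.abs_integral_sub_le hL hdiam hG i hz (hYX ω)) (hw ω)
  simpa using hle

theorem isSubgaussianIncrement_samplingError (hF : IsLossFamily X Q F G) (hR : 0 ≤ R) (hL : 0 ≤ L)
    (hdiam : ∀ y ∈ X, ∀ z ∈ X, ‖y - z‖ ≤ R) (hG : ∀ i, ∀ y ∈ X, ∀ᵐ s ∂Q i, ‖G y s‖ ≤ L)
    (hζ : HasCondLaw μ m w (mixture Q) ζ) (hm : m ≤ mΩ) (hY : Measurable[m] Y)
    (hYX : ∀ ω, Y ω ∈ X) (hz : z ∈ X) :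
    IsSubgaussianIncrement μ m (fun ω => samplingError Q F z (Y ω) (ζ ω) -
      ∫ s, samplingError Q F z (Y ω) s ∂mixture Q (w ω)) ((R * L).toNNReal ^ 2) := by
  refine hζ.isSubgaussianIncrement_sub_integral hm hY (hF.measurable_samplingError z)
    (c := fun ω => objective Q F (Y ω) - objective Q F z) fun ω => ?_
  rw [Real.coe_toNNReal _ (mul_nonneg hR hL)]
  filter_upwards [ae_mixture (fun i => hG i _ (hYX ω)) (w ω),
    ae_mixture (fun i => hG i z hz) (w ω)] with s hys hzs
  exact hF.abs_samplingError_sub_le hR hdiam (hYX ω) hz hys hzs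

end IsLossFamily

end Sampling

section Lag

variable {E : Type*} [NormedAddCommGroup E] [NormedSpace ℝ E] [MeasurableSpace E]
  {Ξ : Type*} [MeasurableSpace Ξ] {n : ℕ} {X : Set E} {Q : Fin n → Measure Ξ}
  [∀ i, IsProbabilityMeasure (Q i)] {F : E → Ξ → ℝ} {G : E → Ξ → StrongDual ℝ E} {R L : ℝ}
  {Ω : Type*} [MeasurableSpace Ω] {μ : Measure Ω} [IsProbabilityMeasure μ]
  {P : Matrix (Fin n) (Fin n) ℝ} {token : ℕ → Ω → Fin n} {ξ : ℕ → Ω → Ξ}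
  {Y : ℕ → Ω → E} {z : E}

theorem IsTokenSampling.integrable_samplingError (hξ : IsTokenSampling μ P Q token ξ)
    (hP : P ∈ doublyStochastic ℝ (Fin n)) (hF : IsLossFamily X Q F G) (hL : 0 < L)
    (hdiam : ∀ y ∈ X, ∀ z ∈ X, ‖y - z‖ ≤ R) (hG : ∀ i, ∀ y ∈ X, HasSecondMomentLE (Q i) (G y) L)
    (hn : n ≠ 0) (hY : ∀ t, Measurable[history token ξ t] (Y t)) (hYX : ∀ t ω, Y t ω ∈ X)
    (hz : z ∈ X) (t τ : ℕ) :
    Integrable (fun ω => samplingError Q F z (Y t ω) (ξ (t + τ + 1) ω)) μ :=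
  hF.integrable_samplingError hL hdiam hG hn (hξ.hasCondLaw hP t τ) (hξ.history_le t) (hY t)
    (hYX t) hz

theorem integral_sum_samplingError_le (hξ : IsTokenSampling μ P Q token ξ)
    (hP : P ∈ doublyStochastic ℝ (Fin n)) (hσ : secondSingularValue P < 1)
    (hF : IsLossFamily X Q F G) (hL : 0 < L) (hdiam : ∀ y ∈ X, ∀ z ∈ X, ‖y - z‖ ≤ R)
    (hG : ∀ i, ∀ y ∈ X, HasSecondMomentLE (Q i) (G y) L) (hn : n ≠ 0)
    (hY : ∀ t, Measurable[history token ξ t] (Y t)) (hYX : ∀ t ω, Y t ω ∈ X) (hz : z ∈ X)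
    (τ N : ℕ) :
    ∫ ω, ∑ t ∈ Finset.range N, samplingError Q F z (Y t ω) (ξ (t + τ + 1) ω) ∂μ ≤
      N * (√n * secondSingularValue P ^ τ * (R * L)) := by
  rw [integral_finsetSum _ fun t _ =>
    hξ.integrable_samplingError hP hF hL hdiam hG hn hY hYX hz t τ]
  have hbias := Finset.sum_le_card_nsmul (Finset.range N) _ _ fun t _ =>
    hF.integral_samplingError_comp_le hL hdiam hG hn (hξ.hasCondLaw hP t τ) (hξ.history_le t)
      (hY t) (hYX t) hz fun ω =>
        sum_abs_vecMul_pow_sub_le hP hσ (hξ.nextTokenLaw_mem_stdSimplex hP t ω) τ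
  rwa [Finset.card_range, nsmul_eq_mul] at hbias

theorem measureReal_sum_samplingError_ge_le (hξ : IsTokenSampling μ P Q token ξ)
    (hP : P ∈ doublyStochastic ℝ (Fin n)) (hσ : secondSingularValue P < 1)
    (hF : IsLossFamily X Q F G) (hL : 0 < L) (hdiam : ∀ y ∈ X, ∀ z ∈ X, ‖y - z‖ ≤ R)
    (hG : ∀ i, ∀ y ∈ X, ∀ᵐ s ∂Q i, ‖G y s‖ ≤ L)
    (hY : ∀ t, Measurable[history token ξ t] (Y t)) (hYX : ∀ t ω, Y t ω ∈ X) (hz : z ∈ X)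
    (τ N : ℕ) {γ : ℝ} (hγ : 0 ≤ γ) :
    μ.real {ω | N * (√n * secondSingularValue P ^ τ * (R * L)) + γ ≤
        ∑ t ∈ Finset.range N, samplingError Q F z (Y t ω) (ξ (t + τ + 1) ω)} ≤
      Real.exp (-γ ^ 2 / (2 * ((τ + 1 : ℕ) * (N * (R * L) ^ 2)))) := by
  have hR : 0 ≤ R := (norm_nonneg _).trans (hdiam z hz z hz)
  have hφ := hF.measurable_samplingError z
  have hlaw := fun t => hξ.hasCondLaw hP t τ
  set ε := √n * secondSingularValue P ^ τ
  let bias t ω := ∫ s, samplingError Q F z (Y t ω) s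
    ∂mixture Q ⟨_, hξ.vecMul_nextTokenLaw_mem_stdSimplex hP t τ ω⟩
  have hbias : ∀ t ω, bias t ω ≤ ε * (R * L) := fun t ω =>
    hF.integral_samplingError_le (mul_nonneg hR hL.le) (hYX t ω) hz
      (fun i => hF.abs_integral_sub_le hL hdiam (fun i y hy => hasSecondMomentLE_of_ae_norm_le
        hF.measurable_subgradient.of_uncurry_left.norm.aestronglyMeasurable (hG i y hy))
        i hz (hYX t ω))
      (sum_abs_vecMul_pow_sub_le hP hσ (hξ.nextTokenLaw_mem_stdSimplex hP t ω) τ)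
  have hadapted : ∀ t, Measurable[history token ξ (t + (τ + 1))] fun ω =>
      samplingError Q F z (Y t ω) (ξ (t + τ + 1) ω) - bias t ω := fun t =>
    (measurable_sub_integral_kernel (κ := mixture Q) hφ).comp
      ((((hY t).prodMk (hlaw t).measurable_param).mono (history_mono (by lia)) le_rfl).prodMk
        (measurable_sample_history ⟨by lia, by lia⟩))
  have htail := measureReal_sum_range_ge_le history_mono τ.succ_pos hadapted (fun t =>
    hF.isSubgaussianIncrement_samplingError hR hL.le hdiam hG (hlaw t) (hξ.history_le t) (hY t)
      (hYX t) hz) N hγ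
  rw [NNReal.coe_pow, Real.coe_toNNReal _ (mul_nonneg hR hL.le)] at htail
  refine (measureReal_mono fun ω hω => ?_).trans htail
  simp only [Set.mem_ofPred_eq, Finset.sum_sub_distrib] at hω ⊢
  have hsum := Finset.sum_le_card_nsmul (Finset.range N) (bias · ω) _ fun t _ => hbias t ω
  rw [Finset.card_range, nsmul_eq_mul] at hsum
  linarith

end Lag

namespace IsMirrorDescent

variable {E : Type*} [NormedAddCommGroup E] [NormedSpace ℝ E] {X : Set E} {ψ : E → ℝ} {R : ℝ}
  {Ω Ξ : Type*} {G : E → Ξ → StrongDual ℝ E} {α : ℕ → ℝ} {ξ : ℕ → Ω → Ξ} {x : ℕ → Ω → E}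

theorem mem_succ (hx : IsMirrorDescent X ψ G α ξ x) (t : ℕ) (ω : Ω) : x (t + 1) ω ∈ X := by
  cases t with
  | zero =>
    obtain ⟨x₁, hx₁, hfirst⟩ := hx.first
    rwa [hfirst]
  | succ t => exact hx.mem (t + 1) (by lia) ω

theorem isMirrorPath (hx : IsMirrorDescent X ψ G α ξ x) (hα : ∀ t, 0 < α (t + 1))
    (hα' : Antitone fun t => α (t + 1)) (ω : Ω) :
    IsMirrorPath X ψ (fun t => α (t + 1)) (fun t => G (x (t + 1) ω) (ξ (t + 1) ω))
      fun t => x (t + 1) ω where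
  mem t := hx.mem_succ t ω
  step_pos := hα
  step_antitone := hα'
  isMinOn t := hx.argmin (t + 1) (by lia) ω

theorem measurable_history [MeasurableSpace E] [BorelSpace E] [MeasurableSpace Ξ] {n : ℕ}
    (hx : IsMirrorDescent X ψ G α ξ x) (hψ : IsProxSetup X ψ R)
    (hG : Measurable (Function.uncurry G)) (hα : ∀ t, 0 < α (t + 1)) (token : ℕ → Ω → Fin n)
    (t : ℕ) : Measurable[history token ξ t] (x (t + 1)) := by
  induction t with
  | zero =>
    obtain ⟨x₁, -, hfirst⟩ := hx.first
    rw [zero_add, show x 1 = fun _ => x₁ from funext hfirst]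
    exact measurable_const
  | succ t ih =>
    have hpast : Measurable[history token ξ (t + 1)] (x (t + 1)) :=
      ih.mono (history_mono t.le_succ) le_rfl
    have hgrad : Measurable[history token ξ (t + 1)] fun ω => G (x (t + 1) ω) (ξ (t + 1) ω) :=
      hG.comp (hpast.prodMk (measurable_sample_history ⟨by lia, le_rfl⟩))
    let _ : MeasurableSpace Ω := history token ξ (t + 1)
    exact hψ.measurable_of_isMinOn (hα t) hpast (hx.mem_succ t) hgrad (hx.mem_succ (t + 1))
      (hx.argmin (t + 1) (by lia))

end IsMirrorDescent

section Gap

theorem one_sub_le_measureReal_of_ae {Ω : Type*} [MeasurableSpace Ω] {μ : Measure Ω}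
    [IsProbabilityMeasure μ] {A B : Set Ω} {δ : ℝ} (hA : μ.real A ≤ δ)
    (hAB : ∀ᵐ ω ∂μ, ω ∉ A → ω ∈ B) : 1 - δ ≤ μ.real B := by
  have huniv : (Set.univ : Set Ω) ≤ᵐ[μ] (A ∪ B : Set Ω) :=
    hAB.mono fun ω hω _ => or_iff_not_imp_left.2 hω
  have hcover : μ.real Set.univ ≤ μ.real (A ∪ B) :=
    ENNReal.toReal_mono (measure_ne_top _ _) (measure_mono_ae huniv)
  rw [probReal_univ] at hcover
  linarith [measureReal_union_le (μ := μ) A B]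

theorem measurable_averageIterate {E Ω : Type*} [NormedAddCommGroup E] [NormedSpace ℝ E]
    [MeasurableSpace E] [BorelSpace E] [MeasurableSpace Ω] {X : Set E} {x : ℕ → Ω → E}
    (hX : IsCompact X) (hx : ∀ t, Measurable (x (t + 1))) (hxX : ∀ t ω, x (t + 1) ω ∈ X) (T : ℕ) :
    Measurable (averageIterate x T) := by
  have hsm : ∀ t, StronglyMeasurable (x (t + 1)) := fun t =>
    stronglyMeasurable_iff_measurable_separable.2
      ⟨hx t, hX.isSeparable.mono (Set.range_subset_iff.2 (hxX t))⟩
  rw [funext (averageIterate_eq_sum x T)]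
  exact (Finset.stronglyMeasurable_fun_sum _ fun t _ => (hsm t).const_smul _).measurable

variable {E : Type*} [NormedAddCommGroup E] [NormedSpace ℝ E] [MeasurableSpace E]
  {Ξ : Type*} [MeasurableSpace Ξ] {n : ℕ} {X : Set E} {Q : Fin n → Measure Ξ}
  {F : E → Ξ → ℝ} {G : E → Ξ → StrongDual ℝ E} {ψ : E → ℝ} {R L : ℝ}
  {Ω : Type*} {α : ℕ → ℝ} {ξ : ℕ → Ω → Ξ} {x : ℕ → Ω → E} {z : E}

theorem IsMirrorDescent.sum_objective_sub_le (hx : IsMirrorDescent X ψ G α ξ x)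
    (hψ : IsProxSetup X ψ R) (hF : IsLossFamily X Q F G) (hα : ∀ t, 0 < α (t + 1))
    (hα' : Antitone fun t => α (t + 1)) (hz : z ∈ X) {C : ℝ}
    (hC : ∀ y ∈ X, objective Q F y - objective Q F z ≤ C) (τ N : ℕ) (ω : Ω) :
    ∑ t ∈ Finset.range (N + 1 + τ), (objective Q F (x (t + 1) ω) - objective Q F z) ≤
      ∑ t ∈ Finset.range (N + 1), samplingError Q F z (x (t + 1) ω) (ξ (t + τ + 1) ω) +
        driftRegretCost (fun t => α (t + 1)) τ (N + 1)
          (fun t => ‖G (x (t + 1) ω) (ξ (t + τ + 1) ω)‖ ^ 2)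
          (fun t => ‖G (x (t + 1) ω) (ξ (t + 1) ω)‖ ^ 2) +
        R ^ 2 / (2 * α (τ + N + 1)) + τ * C :=
  (hx.isMirrorPath hα hα' ω).sum_gap_le (Fs := fun t y => F y (ξ (t + 1) ω))
    (Gs := fun t y => G y (ξ (t + 1) ω)) hψ (fun t => hF.subgradient (ξ (t + 1) ω)) hz hC τ N

/-- The bound on drift, regret and boundary in the optimality gap summed over `N + 1 + τ` steps,
when the subgradients have size `L` and are judged by the samples drawn `τ` steps later. -/
noncomputable def lagCost (α : ℕ → ℝ) (R L : ℝ) (τ N : ℕ) : ℝ :=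
  (τ + 1 / 2) * L ^ 2 * ∑ t ∈ Finset.range (N + 1), α (t + 1) + R ^ 2 / (2 * α (τ + N + 1)) +
    τ * (R * L)

variable [∀ i, IsProbabilityMeasure (Q i)] [MeasurableSpace Ω] {μ : Measure Ω}
  [IsProbabilityMeasure μ]

theorem IsLossFamily.integrable_objective_comp (hF : IsLossFamily X Q F G) {C : ℝ}
    (hC : ∀ y ∈ X, |objective Q F y - objective Q F z| ≤ C) {Y : Ω → E} (hY : Measurable Y)
    (hYX : ∀ ω, Y ω ∈ X) : Integrable (fun ω => objective Q F (Y ω)) μ := by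
  refine (integrable_const (C + |objective Q F z|)).mono'
    (hF.measurable_objective.comp hY).aestronglyMeasurable (.of_forall fun ω => ?_)
  rw [Real.norm_eq_abs]
  linarith [hC _ (hYX ω), abs_sub_abs_le_abs_sub (objective Q F (Y ω)) (objective Q F z)]

variable {P : Matrix (Fin n) (Fin n) ℝ} {token : ℕ → Ω → Fin n}

namespace IsMirrorDescent

variable [BorelSpace E]

theorem hasSecondMomentLE_subgradient (hx : IsMirrorDescent X ψ G α ξ x) (hψ : IsProxSetup X ψ R)
    (hF : IsLossFamily X Q F G) (hξ : IsTokenSampling μ P Q token ξ)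
    (hP : P ∈ doublyStochastic ℝ (Fin n)) (hα : ∀ t, 0 < α (t + 1))
    (hG : ∀ i, ∀ y ∈ X, HasSecondMomentLE (Q i) (G y) L) (t k : ℕ) :
    HasSecondMomentLE μ (fun ω => G (x (t + 1) ω) (ξ (t + k + 1) ω)) L :=
  (hξ.hasCondLaw hP t k).hasSecondMomentLE (hξ.history_le t)
    (hx.measurable_history hψ hF.measurable_subgradient hα token t) hF.measurable_subgradient
    fun ω => .mixture (fun i => hG i _ (hx.mem_succ t ω)) _

theorem integrable_objective (hx : IsMirrorDescent X ψ G α ξ x) (hψ : IsProxSetup X ψ R)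
    (hF : IsLossFamily X Q F G) (hξ : IsTokenSampling μ P Q token ξ) (hα : ∀ t, 0 < α (t + 1))
    {C : ℝ} (hC : ∀ y ∈ X, |objective Q F y - objective Q F z| ≤ C) (t : ℕ) :
    Integrable (fun ω => objective Q F (x (t + 1) ω)) μ :=
  hF.integrable_objective_comp hC ((hx.measurable_history hψ hF.measurable_subgradient hα token
    t).mono (hξ.history_le t) le_rfl) (hx.mem_succ t)

theorem integrable_objective_averageIterate (hx : IsMirrorDescent X ψ G α ξ x)
    (hψ : IsProxSetup X ψ R) (hF : IsLossFamily X Q F G) (hξ : IsTokenSampling μ P Q token ξ)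
    (hα : ∀ t, 0 < α (t + 1)) {C : ℝ} (hC : ∀ y ∈ X, |objective Q F y - objective Q F z| ≤ C)
    {T : ℕ} (hT : 1 ≤ T) : Integrable (fun ω => objective Q F (averageIterate x T ω)) μ :=
  hF.integrable_objective_comp hC (measurable_averageIterate hψ.isCompact (fun t =>
    (hx.measurable_history hψ hF.measurable_subgradient hα token t).mono (hξ.history_le t) le_rfl)
    hx.mem_succ T) fun ω => averageIterate_mem hψ.convex (hx.mem_succ · ω) hT

theorem ae_norm_subgradient_le (hx : IsMirrorDescent X ψ G α ξ x) (hψ : IsProxSetup X ψ R)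
    (hF : IsLossFamily X Q F G) (hξ : IsTokenSampling μ P Q token ξ)
    (hP : P ∈ doublyStochastic ℝ (Fin n)) (hα : ∀ t, 0 < α (t + 1))
    (hG : ∀ i, ∀ y ∈ X, ∀ᵐ s ∂Q i, ‖G y s‖ ≤ L) (k : ℕ) :
    ∀ᵐ ω ∂μ, ∀ t, ‖G (x (t + 1) ω) (ξ (t + k + 1) ω)‖ ≤ L :=
  ae_all_iff.2 fun t => (hξ.hasCondLaw hP t k).ae_of_forall_ae (hξ.history_le t)
    (hx.measurable_history hψ hF.measurable_subgradient hα token t)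
    (p := fun y s => ‖G y s‖ ≤ L) (measurableSet_le hF.measurable_subgradient.norm measurable_const)
    fun ω => ae_mixture (fun i => hG i _ (hx.mem_succ t ω)) _

theorem integral_sum_objective_sub_le (hx : IsMirrorDescent X ψ G α ξ x) (hψ : IsProxSetup X ψ R)
    (hF : IsLossFamily X Q F G) (hξ : IsTokenSampling μ P Q token ξ)
    (hP : P ∈ doublyStochastic ℝ (Fin n)) (hσ : secondSingularValue P < 1) (hn : n ≠ 0)
    (hR : 0 ≤ R) (hL : 0 < L) (hα : ∀ t, 0 < α (t + 1)) (hα' : Antitone fun t => α (t + 1))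
    (hG : ∀ i, ∀ y ∈ X, HasSecondMomentLE (Q i) (G y) L) (hz : z ∈ X) (τ N : ℕ) :
    ∫ ω, ∑ t ∈ Finset.range (N + 1 + τ), (objective Q F (x (t + 1) ω) - objective Q F z) ∂μ ≤
      (N + 1 : ℕ) * (√n * secondSingularValue P ^ τ * (R * L)) + lagCost α R L τ N := by
  have hdiam : ∀ y ∈ X, ∀ z ∈ X, ‖y - z‖ ≤ R := fun y hy z hz => hψ.norm_sub_le hR hy hz
  have hC : ∀ y ∈ X, |objective Q F y - objective Q F z| ≤ R * L := fun y hy =>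
    hF.abs_objective_sub_le hn hL hdiam hG hy hz
  have hmeas := hx.measurable_history hψ hF.measurable_subgradient hα token
  have hgap : Integrable (fun ω => ∑ t ∈ Finset.range (N + 1 + τ),
      (objective Q F (x (t + 1) ω) - objective Q F z)) μ := integrable_finsetSum _ fun t _ =>
    (hx.integrable_objective hψ hF hξ hα hC t).sub (integrable_const _)
  have herr := integrable_finsetSum (Finset.range (N + 1)) fun t _ =>
    hξ.integrable_samplingError hP hF hL hdiam hG hn hmeas hx.mem_succ hz t τ
  have herr' := integral_sum_samplingError_le hξ hP hσ hF hL hdiam hG hn hmeas hx.mem_succ hz τ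
    (N + 1)
  have hsq := hx.hasSecondMomentLE_subgradient hψ hF hξ hP hα hG
  have hcost := integrable_driftRegretCost (fun t => α (t + 1)) τ (N + 1) (fun t => (hsq t τ).1)
    fun t => (hsq t 0).1
  have hcost' := integral_driftRegretCost_le (fun t => (hα t).le) hα' (τ := τ) (N := N + 1)
    (sq_nonneg L) (fun t => (hsq t τ).1) (fun t => (hsq t 0).1) (fun t => (hsq t τ).2)
    fun t => (hsq t 0).2
  simp only [add_zero] at hcost hcost'
  have hle := integral_mono hgap ((herr.add hcost).add (integrable_const _)) fun ω =>
    (hx.sum_objective_sub_le hψ hF hα hα' hz (fun y hy => (abs_le.1 (hC y hy)).2) τ N ω).trans_eq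
      (add_assoc _ _ _)
  rw [integral_add' (herr.add hcost) (integrable_const _), integral_add' herr hcost,
    integral_const, probReal_univ, one_smul] at hle
  rw [lagCost]
  linarith

theorem ae_sum_objective_sub_le (hx : IsMirrorDescent X ψ G α ξ x) (hψ : IsProxSetup X ψ R)
    (hF : IsLossFamily X Q F G) (hξ : IsTokenSampling μ P Q token ξ)
    (hP : P ∈ doublyStochastic ℝ (Fin n)) (hα : ∀ t, 0 < α (t + 1))
    (hα' : Antitone fun t => α (t + 1)) (hG : ∀ i, ∀ y ∈ X, ∀ᵐ s ∂Q i, ‖G y s‖ ≤ L)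
    (hz : z ∈ X) (hC : ∀ y ∈ X, objective Q F y - objective Q F z ≤ R * L) (τ N : ℕ) :
    ∀ᵐ ω ∂μ, ∑ t ∈ Finset.range (N + 1 + τ), (objective Q F (x (t + 1) ω) - objective Q F z) ≤
      ∑ t ∈ Finset.range (N + 1), samplingError Q F z (x (t + 1) ω) (ξ (t + τ + 1) ω) +
        lagCost α R L τ N := by
  filter_upwards [hx.ae_norm_subgradient_le hψ hF hξ hP hα hG τ,
    hx.ae_norm_subgradient_le hψ hF hξ hP hα hG 0] with ω hlag hnow
  have hcost := driftRegretCost_le (fun t => (hα t).le) hα' (sq_nonneg L) (τ := τ) (N := N + 1)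
    (fun t => pow_le_pow_left₀ (norm_nonneg _) (hlag t) 2)
    (fun t => pow_le_pow_left₀ (norm_nonneg _) (hnow t) 2)
  have hgap := hx.sum_objective_sub_le hψ hF hα hα' hz hC τ N ω
  rw [lagCost]
  simp only [add_zero] at hcost
  linarith

theorem measureReal_sum_objective_sub_le (hx : IsMirrorDescent X ψ G α ξ x)
    (hψ : IsProxSetup X ψ R) (hF : IsLossFamily X Q F G) (hξ : IsTokenSampling μ P Q token ξ)
    (hP : P ∈ doublyStochastic ℝ (Fin n)) (hσ : secondSingularValue P < 1) (hn : n ≠ 0)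
    (hR : 0 ≤ R) (hL : 0 < L) (hα : ∀ t, 0 < α (t + 1)) (hα' : Antitone fun t => α (t + 1))
    (hG : ∀ i, ∀ y ∈ X, ∀ᵐ s ∂Q i, ‖G y s‖ ≤ L) (hz : z ∈ X) (τ N : ℕ) {γ : ℝ} (hγ : 0 ≤ γ) :
    1 - Real.exp (-γ ^ 2 / (2 * ((τ + 1 : ℕ) * ((N + 1 : ℕ) * (R * L) ^ 2)))) ≤
      μ.real {ω | ∑ t ∈ Finset.range (N + 1 + τ),
        (objective Q F (x (t + 1) ω) - objective Q F z) ≤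
          (N + 1 : ℕ) * (√n * secondSingularValue P ^ τ * (R * L)) + γ + lagCost α R L τ N} := by
  have hdiam : ∀ y ∈ X, ∀ z ∈ X, ‖y - z‖ ≤ R := fun y hy z hz => hψ.norm_sub_le hR hy hz
  have hC : ∀ y ∈ X, objective Q F y - objective Q F z ≤ R * L := fun y hy => le_of_abs_le <|
    hF.abs_objective_sub_le hn hL hdiam (fun i y hy => hasSecondMomentLE_of_ae_norm_le
      hF.measurable_subgradient.of_uncurry_left.norm.aestronglyMeasurable (hG i y hy)) hy hz
  refine one_sub_le_measureReal_of_ae (measureReal_sum_samplingError_ge_le hξ hP hσ hF hL hdiam hG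
    (hx.measurable_history hψ hF.measurable_subgradient hα token) hx.mem_succ hz τ (N + 1) hγ) ?_
  filter_upwards [hx.ae_sum_objective_sub_le hψ hF hξ hP hα hα' hG hz hC τ N] with ω hgap hω
  rw [not_le] at hω
  exact hgap.trans (by gcongr)

end IsMirrorDescent

end Gap

section StepSize

theorem sum_range_one_div_sqrt_le (N : ℕ) :
    ∑ t ∈ Finset.range N, 1 / √((t : ℝ) + 1) ≤ 2 * √N := by
  induction N with
  | zero => simp
  | succ N ih =>
    have hpos : 0 < √((N : ℝ) + 1) := by positivity
    have hstep : 1 / √((N : ℝ) + 1) ≤ 2 * √((N : ℝ) + 1) - 2 * √N := by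
      rw [div_le_iff₀ hpos]
      nlinarith [sq_nonneg (√((N : ℝ) + 1) - √N), Real.sq_sqrt (Nat.cast_nonneg (α := ℝ) N),
        Real.sq_sqrt (x := (N : ℝ) + 1) (by positivity)]
    rw [Finset.sum_range_succ, Nat.cast_succ]
    linarith

/-- The step sizes `α / √t` with `α = R / (L √θ)`, where `θ` is a mixing time. -/
noncomputable def stepSize (R L θ : ℝ) (t : ℕ) : ℝ :=
  R / (L * √θ) / √t

variable {R L θ : ℝ}

theorem stepSize_succ_pos (hR : 0 < R) (hL : 0 < L) (hθ : 0 < θ) (t : ℕ) :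
    0 < stepSize R L θ (t + 1) := by
  unfold stepSize
  positivity

theorem antitone_stepSize_succ (hR : 0 ≤ R) (hL : 0 ≤ L) :
    Antitone fun t => stepSize R L θ (t + 1) := fun s t hst => by
  dsimp only [stepSize]
  have : (s : ℝ) ≤ t := mod_cast hst
  gcongr

theorem sum_stepSize_succ_le (hR : 0 ≤ R) (hL : 0 ≤ L) (N : ℕ) :
    ∑ t ∈ Finset.range N, stepSize R L θ (t + 1) ≤ R / (L * √θ) * (2 * √N) := by
  calc ∑ t ∈ Finset.range N, stepSize R L θ (t + 1)
    _ = R / (L * √θ) * ∑ t ∈ Finset.range N, 1 / √((t : ℝ) + 1) := by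
      simp_rw [stepSize, Finset.mul_sum, mul_one_div, Nat.cast_succ]
    _ ≤ R / (L * √θ) * (2 * √N) :=
      mul_le_mul_of_nonneg_left (sum_range_one_div_sqrt_le N) (by positivity)

theorem lagCost_stepSize_le (hR : 0 < R) (hL : 0 < L) (hθ : 0 < θ) {τ : ℕ} (hτ : τ ≤ θ) (N : ℕ) :
    lagCost (stepSize R L θ) R L τ N ≤
      R * L * (5 / 2 * (√θ * √(N + 1 + τ : ℕ)) + √(N + 1 + τ : ℕ) / √θ + θ) := by
  set S := √(N + 1 + τ : ℕ) with hS
  have hS0 : 0 < S := by positivity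
  have hθ' : √θ ^ 2 = θ := Real.sq_sqrt hθ.le
  have hsum : ∑ t ∈ Finset.range (N + 1), stepSize R L θ (t + 1) ≤ R / (L * √θ) * (2 * S) :=
    (sum_stepSize_succ_le hR.le hL.le (N + 1)).trans (by
      have := (N + 1).le_add_right τ
      rw [hS]
      gcongr)
  have hmove : (τ + 1 / 2) * L ^ 2 * ∑ t ∈ Finset.range (N + 1), stepSize R L θ (t + 1) ≤
      R * L * (2 * (√θ * S) + S / √θ) := by
    calc (τ + 1 / 2) * L ^ 2 * ∑ t ∈ Finset.range (N + 1), stepSize R L θ (t + 1)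
      _ ≤ (τ + 1 / 2) * L ^ 2 * (R / (L * √θ) * (2 * S)) := by gcongr
      _ ≤ (θ + 1 / 2) * L ^ 2 * (R / (L * √θ) * (2 * S)) := by gcongr
      _ = R * L * (2 * (√θ * S) + S / √θ) := by
        field_simp
        rw [hθ']
        ring
  have hregret : R ^ 2 / (2 * stepSize R L θ (τ + N + 1)) = R * L * (1 / 2 * (√θ * S)) := by
    rw [stepSize, show τ + N + 1 = N + 1 + τ by ring, ← hS]
    field_simp
  have hboundary : τ * (R * L) ≤ R * L * θ := by
    rw [mul_comm]
    gcongr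
  rw [lagCost, hregret]
  linarith

end StepSize

section TauMix

variable {n : ℕ} {P : Matrix (Fin n) (Fin n) ℝ} {T : ℕ}

theorem log_mul_two_le_tauMix (hn : 2 ≤ n) (hσ : secondSingularValue P < 1) (hT : 1 ≤ T) :
    Real.log (T * 2) ≤ tauMix P T := by
  have hT' : (1 : ℝ) ≤ T := mod_cast hT
  have hn' : (2 : ℝ) ≤ n := mod_cast hn
  have hlog : Real.log (T * 2) ≤ Real.log (T * n) := Real.log_le_log (by positivity) (by gcongr)
  have hlog0 : 0 ≤ Real.log (T * 2) := Real.log_nonneg (by linarith)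
  exact hlog.trans (le_div_self (hlog0.trans hlog) (by linarith)
    (by linarith [secondSingularValue_nonneg P]))

theorem log_two_le_tauMix (hn : 2 ≤ n) (hσ : secondSingularValue P < 1) (hT : 1 ≤ T) :
    Real.log 2 ≤ tauMix P T := by
  have hT' : (1 : ℝ) ≤ T := mod_cast hT
  exact (Real.log_le_log two_pos (by linarith)).trans (log_mul_two_le_tauMix hn hσ hT)

theorem secondSingularValue_pow_floor_tauMix_le (hn : n ≠ 0) (hσ : secondSingularValue P < 1)
    (hT : T ≠ 0) : secondSingularValue P ^ ⌊tauMix P T⌋₊ ≤ Real.exp 1 / (T * n) := by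
  set σ := secondSingularValue P
  have hσ' : σ ≤ Real.exp (-(1 - σ)) := by linarith [Real.add_one_le_exp (-(1 - σ))]
  have hτ : tauMix P T - 1 ≤ ⌊tauMix P T⌋₊ := (Nat.sub_one_lt_floor _).le
  have hmix : (1 - σ) * tauMix P T = Real.log (T * n) := mul_div_cancel₀ _ (by linarith)
  calc σ ^ ⌊tauMix P T⌋₊
    _ ≤ Real.exp (-(1 - σ)) ^ ⌊tauMix P T⌋₊ :=
      pow_le_pow_left₀ (secondSingularValue_nonneg P) hσ' _
    _ = Real.exp (-((1 - σ) * ⌊tauMix P T⌋₊)) := by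
      rw [← Real.exp_nat_mul]
      ring_nf
    _ ≤ Real.exp (1 - Real.log (T * n)) := Real.exp_le_exp.2 (by
      nlinarith [secondSingularValue_nonneg P])
    _ = Real.exp 1 / (T * n) := by rw [Real.exp_sub, Real.exp_log (by positivity)]

theorem mul_sqrt_mul_pow_floor_tauMix_le (hn : 2 ≤ n) (hσ : secondSingularValue P < 1)
    (hT : T ≠ 0) : T * (√n * secondSingularValue P ^ ⌊tauMix P T⌋₊) ≤ 2 := by
  have hn0 : n ≠ 0 := by lia
  have hn' : (2 : ℝ) ≤ n := mod_cast hn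
  have hsq : √n * √n = n := Real.mul_self_sqrt n.cast_nonneg
  have hexp : Real.exp 1 / 2 ≤ √n :=
    Real.le_sqrt_of_sq_le (by nlinarith [Real.exp_one_lt_d9, Real.exp_pos 1])
  calc T * (√n * secondSingularValue P ^ ⌊tauMix P T⌋₊)
    _ ≤ T * (√n * (Real.exp 1 / (T * n))) := by
      gcongr
      exact secondSingularValue_pow_floor_tauMix_le hn0 hσ hT
    _ = Real.exp 1 / √n := by
      field_simp
      rw [sq, hsq]
    _ ≤ 2 := by
      rw [div_le_iff₀ (by positivity)]
      linarith

/-- Here `2 T ≤ exp (T / 2)`, which fails for `T ≤ 3`. -/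
theorem four_le_of_tauMix_le_half (hn : 2 ≤ n) (hσ : secondSingularValue P < 1) (hT : 1 ≤ T)
    (h : tauMix P T ≤ (T : ℝ) / 2) : 4 ≤ T := by
  have hlog := (log_mul_two_le_tauMix hn hσ hT).trans h
  rw [Real.log_le_iff_le_exp (by positivity)] at hlog
  have hsq : ((T : ℝ) * 2) ^ 2 ≤ Real.exp 1 ^ T := by
    calc ((T : ℝ) * 2) ^ 2 ≤ Real.exp (T / 2) ^ 2 := by gcongr
      _ = Real.exp 1 ^ T := by
        rw [← Real.exp_nat_mul, ← Real.exp_nat_mul]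
        ring_nf
  have he := Real.exp_one_lt_d9
  have hpow : Real.exp 1 ^ T ≤ 2.7182818286 ^ T := by gcongr
  have := hsq.trans hpow
  by_contra! hlt
  interval_cases T <;> norm_num at this

theorem one_le_tauMix (hn : 2 ≤ n) (hσ : secondSingularValue P < 1) (hT : 4 ≤ T) :
    1 ≤ tauMix P T := by
  have hT' : (4 : ℝ) ≤ T := mod_cast hT
  refine le_trans ?_ (log_mul_two_le_tauMix hn hσ (by lia))
  rw [Real.le_log_iff_exp_le (by positivity)]
  linarith [Real.exp_one_lt_d9]

end TauMix

section Rates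

variable {n : ℕ} {P : Matrix (Fin n) (Fin n) ℝ} {T : ℕ} {R L : ℝ}

theorem mixing_add_lagCost_stepSize_le (hn : 2 ≤ n) (hσ : secondSingularValue P < 1) (hR : 0 < R)
    (hL : 0 < L) {N : ℕ} (hN : N + 1 + ⌊tauMix P T⌋₊ = T) :
    (N + 1 : ℕ) * (√n * secondSingularValue P ^ ⌊tauMix P T⌋₊ * (R * L)) +
        lagCost (stepSize R L (tauMix P T)) R L ⌊tauMix P T⌋₊ N ≤
      R * L * (5 / 2 * (√(tauMix P T) * √T) + √T / √(tauMix P T) + tauMix P T + 2) := by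
  have hθ : 0 < tauMix P T := (Real.log_pos one_lt_two).trans_le (log_two_le_tauMix hn hσ (by lia))
  have hNT : ((N + 1 : ℕ) : ℝ) ≤ T := mod_cast (by lia)
  have hσ0 := secondSingularValue_nonneg P
  have hmix : (N + 1 : ℕ) * (√n * secondSingularValue P ^ ⌊tauMix P T⌋₊ * (R * L)) ≤
      2 * (R * L) := by
    calc (N + 1 : ℕ) * (√n * secondSingularValue P ^ ⌊tauMix P T⌋₊ * (R * L))
      _ ≤ T * (√n * secondSingularValue P ^ ⌊tauMix P T⌋₊ * (R * L)) := by gcongr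
      _ = T * (√n * secondSingularValue P ^ ⌊tauMix P T⌋₊) * (R * L) := by ring
      _ ≤ 2 * (R * L) := by
        gcongr
        exact mul_sqrt_mul_pow_floor_tauMix_le hn hσ (by lia)
  have hcost := lagCost_stepSize_le hR hL hθ (Nat.floor_le hθ.le) N
  rw [hN] at hcost
  linarith

theorem div_eq_rate {t : ℝ} (ht : 0 < t) (θ c : ℝ) :
    R * L * (5 / 2 * (√θ * √t) + c * √t + θ) / t =
      5 * R * L / 2 * (√θ / √t) + c * (R * L) / √t + R * L / t * θ := by
  have hsq : √t * √t = t := Real.mul_self_sqrt ht.le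
  have hs : 0 < √t := Real.sqrt_pos.2 ht
  generalize √t = s at *
  subst hsq
  field_simp

theorem exp_neg_sq_div_le {c k M t δ : ℝ} (hc : 0 < c) (hk : 0 < k) (hM : 0 < M) (hMt : M ≤ t)
    (hδ : 0 < δ) (hδ' : δ ≤ 1) :
    Real.exp (-(c * √(2 * (k * t) * Real.log (1 / δ))) ^ 2 / (2 * (k * (M * c ^ 2)))) ≤ δ := by
  have hlog : 0 ≤ Real.log (1 / δ) := Real.log_nonneg (by rwa [le_one_div one_pos hδ, div_one])
  have ht : 0 < t := hM.trans_le hMt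
  calc Real.exp (-(c * √(2 * (k * t) * Real.log (1 / δ))) ^ 2 / (2 * (k * (M * c ^ 2))))
    _ = Real.exp (-(t / M * Real.log (1 / δ))) := by
      rw [mul_pow, Real.sq_sqrt (by positivity)]
      congr 1
      field_simp
    _ ≤ Real.exp (-Real.log (1 / δ)) := Real.exp_le_exp.2 <| neg_le_neg <|
      le_mul_of_one_le_left hlog ((one_le_div hM).2 hMt)
    _ = δ := by rw [one_div, Real.log_inv, neg_neg, Real.exp_log hδ]

theorem deviation_le {k t θ δ : ℝ} (hk : k ≤ θ) (ht : 0 ≤ t) (hθ : 1 ≤ θ) (hδ : 0 < δ)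
    (hδ' : δ ≤ 1) :
    √(2 * ((k + 1) * t) * Real.log (1 / δ)) ≤ 3 * √(θ * Real.log (θ / δ)) * √t := by
  have hlog : 0 ≤ Real.log (1 / δ) := Real.log_nonneg (by rwa [le_one_div one_pos hδ, div_one])
  have hlog' : Real.log (1 / δ) ≤ Real.log (θ / δ) :=
    Real.log_le_log (by positivity) (by gcongr)
  calc √(2 * ((k + 1) * t) * Real.log (1 / δ))
    _ ≤ √(3 ^ 2 * (θ * Real.log (θ / δ)) * t) := Real.sqrt_le_sqrt <| by
      calc 2 * ((k + 1) * t) * Real.log (1 / δ)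
        _ ≤ 2 * ((θ + θ) * t) * Real.log (θ / δ) := by gcongr
        _ = 4 * (θ * Real.log (θ / δ) * t) := by ring
        _ ≤ 9 * (θ * Real.log (θ / δ) * t) := by
          have := hlog.trans hlog'
          gcongr
          norm_num
        _ = 3 ^ 2 * (θ * Real.log (θ / δ)) * t := by ring
    _ = 3 * √(θ * Real.log (θ / δ)) * √t := by
      rw [Real.sqrt_mul' _ ht, Real.sqrt_mul (by positivity), Real.sqrt_sq (by norm_num)]

end Rates

namespace IsMirrorDescent

variable {E : Type*} [NormedAddCommGroup E] [NormedSpace ℝ E] [MeasurableSpace E] [BorelSpace E]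
  {Ξ : Type*} [MeasurableSpace Ξ] {n : ℕ} {X : Set E} {Q : Fin n → Measure Ξ}
  [∀ i, IsProbabilityMeasure (Q i)] {F : E → Ξ → ℝ} {G : E → Ξ → StrongDual ℝ E} {ψ : E → ℝ}
  {R L : ℝ} {Ω : Type*} [MeasurableSpace Ω] {μ : Measure Ω} [IsProbabilityMeasure μ]
  {P : Matrix (Fin n) (Fin n) ℝ} {token : ℕ → Ω → Fin n} {ξ : ℕ → Ω → Ξ} {x : ℕ → Ω → E} {z : E}
  {T : ℕ}

theorem integral_sum_objective_sub_le_of_stepSize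
    (hx : IsMirrorDescent X ψ G (stepSize R L (tauMix P T)) ξ x) (hψ : IsProxSetup X ψ R)
    (hF : IsLossFamily X Q F G) (hξ : IsTokenSampling μ P Q token ξ)
    (hP : P ∈ doublyStochastic ℝ (Fin n)) (hσ : secondSingularValue P < 1) (hn : 2 ≤ n)
    (hR : 0 < R) (hL : 0 < L) (hG : ∀ i, ∀ y ∈ X, HasSecondMomentLE (Q i) (G y) L) (hz : z ∈ X)
    (hT : 1 ≤ T) :
    ∫ ω, ∑ t ∈ Finset.range T, (objective Q F (x (t + 1) ω) - objective Q F z) ∂μ ≤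
      R * L * (5 / 2 * (√(tauMix P T) * √T) + √T / √(tauMix P T) + tauMix P T + 2) := by
  have hn0 : n ≠ 0 := by lia
  have hθ : 0 < tauMix P T := (Real.log_pos one_lt_two).trans_le (log_two_le_tauMix hn hσ hT)
  have hα := stepSize_succ_pos hR hL hθ
  rcases le_or_gt T ⌊tauMix P T⌋₊ with hTθ | hTθ
  · have hC : ∀ y ∈ X, |objective Q F y - objective Q F z| ≤ R * L := fun y hy =>
      hF.abs_objective_sub_le hn0 hL (fun y hy z hz => hψ.norm_sub_le hR.le hy hz) hG hy hz
    have hTθ' : (T : ℝ) ≤ tauMix P T := (Nat.cast_le.2 hTθ).trans (Nat.floor_le hθ.le)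
    have hgap : ∀ t, ∫ ω, (objective Q F (x (t + 1) ω) - objective Q F z) ∂μ ≤ R * L := fun t => by
      simpa using integral_mono ((hx.integrable_objective hψ hF hξ hα hC t).sub
        (integrable_const _)) (integrable_const (R * L))
        fun ω => (abs_le.1 (hC _ (hx.mem_succ t ω))).2
    calc ∫ ω, ∑ t ∈ Finset.range T, (objective Q F (x (t + 1) ω) - objective Q F z) ∂μ
      _ = ∑ t ∈ Finset.range T, ∫ ω, (objective Q F (x (t + 1) ω) - objective Q F z) ∂μ :=
        integral_finsetSum _ fun t _ =>
          (hx.integrable_objective hψ hF hξ hα hC t).sub (integrable_const _)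
      _ ≤ T * (R * L) := by
        simpa using Finset.sum_le_card_nsmul (Finset.range T) _ _ fun t _ => hgap t
      _ ≤ tauMix P T * (R * L) := by gcongr
      _ = R * L * tauMix P T := mul_comm _ _
      _ ≤ _ := by
        gcongr
        have : 0 ≤ 5 / 2 * (√(tauMix P T) * √T) + √T / √(tauMix P T) := by positivity
        linarith
  · obtain ⟨N, hN⟩ : ∃ N, N + 1 + ⌊tauMix P T⌋₊ = T := ⟨T - 1 - ⌊tauMix P T⌋₊, by lia⟩
    have hsum := hx.integral_sum_objective_sub_le hψ hF hξ hP hσ hn0 hR.le hL hα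
      (antitone_stepSize_succ hR.le hL.le) hG hz ⌊tauMix P T⌋₊ N
    rw [hN] at hsum
    exact hsum.trans (mixing_add_lagCost_stepSize_le hn hσ hR hL hN)

theorem integral_objective_averageIterate_sub_le
    (hx : IsMirrorDescent X ψ G (stepSize R L (tauMix P T)) ξ x) (hψ : IsProxSetup X ψ R)
    (hF : IsLossFamily X Q F G) (hξ : IsTokenSampling μ P Q token ξ)
    (hP : P ∈ doublyStochastic ℝ (Fin n)) (hσ : secondSingularValue P < 1) (hn : 2 ≤ n)
    (hR : 0 < R) (hL : 0 < L) (hG : ∀ i, ∀ y ∈ X, HasSecondMomentLE (Q i) (G y) L) (hz : z ∈ X)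
    (hT : 1 ≤ T) :
    Integrable (fun ω => objective Q F (averageIterate x T ω)) μ ∧
      ∫ ω, objective Q F (averageIterate x T ω) ∂μ - objective Q F z ≤
        5 * R * L / 2 * (√(tauMix P T) / √T) + 5 * (R * L) / √T + R * L / T * tauMix P T := by
  have hC : ∀ y ∈ X, |objective Q F y - objective Q F z| ≤ R * L := fun y hy =>
    hF.abs_objective_sub_le (by lia) hL (fun y hy z hz => hψ.norm_sub_le hR.le hy hz) hG hy hz
  have hθ := log_two_le_tauMix hn hσ hT
  have hα := stepSize_succ_pos hR hL ((Real.log_pos one_lt_two).trans_le hθ)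
  have havg := hx.integrable_objective_averageIterate hψ hF hξ hα hC hT
  have hT' : (1 : ℝ) ≤ T := mod_cast hT
  have hsqrt : 1 ≤ √(T : ℝ) := Real.one_le_sqrt.2 hT'
  have hdiv : √T / √(tauMix P T) ≤ 2 * √T := by
    have : 1 / 2 ≤ √(tauMix P T) := Real.le_sqrt_of_sq_le (by linarith [Real.log_two_gt_d9])
    rw [div_le_iff₀ (by linarith)]
    nlinarith
  refine ⟨havg, ?_⟩
  calc ∫ ω, objective Q F (averageIterate x T ω) ∂μ - objective Q F z
    _ ≤ (∫ ω, ∑ t ∈ Finset.range T, (objective Q F (x (t + 1) ω) - objective Q F z) ∂μ) / T :=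
      integral_apply_averageIterate_sub_le (hF.convexOn_objective hψ.convex) hx.mem_succ hT havg
        (hx.integrable_objective hψ hF hξ hα hC) z
    _ ≤ R * L * (5 / 2 * (√(tauMix P T) * √T) + 5 * √T + tauMix P T) / T := by
      gcongr
      exact (hx.integral_sum_objective_sub_le_of_stepSize hψ hF hξ hP hσ hn hR hL hG hz hT).trans
        (mul_le_mul_of_nonneg_left (by linarith) (by positivity))
    _ = _ := div_eq_rate (by linarith) _ _

theorem measureReal_sum_objective_sub_le_of_stepSize
    (hx : IsMirrorDescent X ψ G (stepSize R L (tauMix P T)) ξ x) (hψ : IsProxSetup X ψ R)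
    (hF : IsLossFamily X Q F G) (hξ : IsTokenSampling μ P Q token ξ)
    (hP : P ∈ doublyStochastic ℝ (Fin n)) (hσ : secondSingularValue P < 1) (hn : 2 ≤ n)
    (hR : 0 < R) (hL : 0 < L) (hG : ∀ i, ∀ y ∈ X, ∀ᵐ s ∂Q i, ‖G y s‖ ≤ L) (hz : z ∈ X)
    {δ : ℝ} (hδ : 0 < δ) (hδ' : δ ≤ 1) (hθ : 1 ≤ tauMix P T) (hθT : tauMix P T < T) :
    1 - δ ≤ μ.real {ω | ∑ t ∈ Finset.range T, (objective Q F (x (t + 1) ω) - objective Q F z) ≤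
      R * L * (5 / 2 * (√(tauMix P T) * √T) + √T / √(tauMix P T) + tauMix P T + 2 +
        3 * √(tauMix P T * Real.log (tauMix P T / δ)) * √T)} := by
  have hfloor : (⌊tauMix P T⌋₊ : ℝ) ≤ tauMix P T := Nat.floor_le (by linarith)
  have hτT : ⌊tauMix P T⌋₊ < T := Nat.cast_lt.1 (hfloor.trans_lt hθT)
  obtain ⟨N, hN⟩ : ∃ N, N + 1 + ⌊tauMix P T⌋₊ = T := ⟨T - 1 - ⌊tauMix P T⌋₊, by lia⟩
  have hNT : ((N + 1 : ℕ) : ℝ) ≤ T := mod_cast (by lia)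
  have hprob := hx.measureReal_sum_objective_sub_le hψ hF hξ hP hσ (by lia) hR.le hL
    (stepSize_succ_pos hR hL (by linarith)) (antitone_stepSize_succ hR.le hL.le) hG hz
    ⌊tauMix P T⌋₊ N (γ := R * L * √(2 * ((⌊tauMix P T⌋₊ + 1 : ℕ) * T) * Real.log (1 / δ)))
    (by positivity)
  have htail := exp_neg_sq_div_le (c := R * L) (k := (⌊tauMix P T⌋₊ + 1 : ℕ)) (M := (N + 1 : ℕ))
    (by positivity) (by positivity) (by positivity) hNT hδ hδ'
  refine (sub_le_sub_left htail 1).trans (hprob.trans (measureReal_mono fun ω hω => ?_))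
  rw [Set.mem_ofPred_eq, hN, Nat.cast_succ ⌊tauMix P T⌋₊] at hω
  have hbudget := mixing_add_lagCost_stepSize_le hn hσ hR hL hN
  have hdev := mul_le_mul_of_nonneg_left
    (deviation_le hfloor T.cast_nonneg hθ hδ hδ') (mul_pos hR hL).le
  rw [Set.mem_ofPred_eq, mul_add]
  linarith

theorem measureReal_objective_averageIterate_sub_le
    (hx : IsMirrorDescent X ψ G (stepSize R L (tauMix P T)) ξ x) (hψ : IsProxSetup X ψ R)
    (hF : IsLossFamily X Q F G) (hξ : IsTokenSampling μ P Q token ξ)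
    (hP : P ∈ doublyStochastic ℝ (Fin n)) (hσ : secondSingularValue P < 1) (hn : 2 ≤ n)
    (hR : 0 < R) (hL : 0 < L) (hG : ∀ i, ∀ y ∈ X, ∀ᵐ s ∂Q i, ‖G y s‖ ≤ L) (hz : z ∈ X)
    (hT : 1 ≤ T) {δ : ℝ} (hδ : 0 < δ) (hδ' : δ ≤ 1) (hθT : tauMix P T ≤ (T : ℝ) / 2) :
    1 - δ ≤ μ.real {ω | objective Q F (averageIterate x T ω) - objective Q F z ≤
      5 * R * L / 2 * (√(tauMix P T) / √T) +
        (2 + 3 * √(tauMix P T * Real.log (tauMix P T / δ))) * (R * L) / √T +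
        R * L / T * tauMix P T} := by
  have hT4 := four_le_of_tauMix_le_half hn hσ hT hθT
  have hT4' : (4 : ℝ) ≤ T := mod_cast hT4
  have hθ : 1 ≤ tauMix P T := one_le_tauMix hn hσ hT4
  have hsqrt : 2 ≤ √(T : ℝ) := Real.le_sqrt_of_sq_le (by linarith)
  have hdiv : √T / √(tauMix P T) ≤ √T := div_le_self (by positivity) (Real.one_le_sqrt.2 hθ)
  refine (hx.measureReal_sum_objective_sub_le_of_stepSize hψ hF hξ hP hσ hn hR hL hG hz hδ hδ' hθ
    (by linarith)).trans (measureReal_mono fun ω hω => ?_)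
  calc objective Q F (averageIterate x T ω) - objective Q F z
    _ ≤ (∑ t ∈ Finset.range T, (objective Q F (x (t + 1) ω) - objective Q F z)) / T :=
      apply_averageIterate_sub_le (hF.convexOn_objective hψ.convex) (hx.mem_succ · ω) hT z
    _ ≤ R * L * (5 / 2 * (√(tauMix P T) * √T) +
        (2 + 3 * √(tauMix P T * Real.log (tauMix P T / δ))) * √T + tauMix P T) / T := by
      gcongr
      exact hω.trans (mul_le_mul_of_nonneg_left (by linarith) (by positivity))
    _ = _ := div_eq_rate (by linarith) _ _

end IsMirrorDescent

theorem corollary3_general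
    {E : Type*} [NormedAddCommGroup E] [NormedSpace ℝ E]
    [MeasurableSpace E] [BorelSpace E]
    {Ξ : Type*} [MeasurableSpace Ξ]
    {Ω : Type*} [MeasurableSpace Ω] (μ : Measure Ω) [IsProbabilityMeasure μ]
    (X : Set E) (ψ : E → ℝ) (R L : ℝ) (hR : 0 < R) (hL : 0 < L) (hψ : IsProxSetup X ψ R)
    (n : ℕ) (hn : 2 ≤ n)
    (P : Matrix (Fin n) (Fin n) ℝ) (hP : P ∈ doublyStochastic ℝ (Fin n))
    (hσ : secondSingularValue P < 1)
    (Q : Fin n → Measure Ξ) [∀ i, IsProbabilityMeasure (Q i)]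
    (F : E → Ξ → ℝ) (G : E → Ξ → StrongDual ℝ E) (hF : IsLossFamily X Q F G)
    (token : ℕ → Ω → Fin n) (ξ : ℕ → Ω → Ξ) (hξ : IsTokenSampling μ P Q token ξ)
    (T : ℕ) (hT : 1 ≤ T)
    (x : ℕ → Ω → E)
    (hx : IsMirrorDescent X ψ G
      (fun t => (R / (L * Real.sqrt (tauMix P T))) / Real.sqrt (t : ℝ)) ξ x)
    (xstar : E) (hxstar : xstar ∈ X) :
    ((∀ i, ∀ y ∈ X, Integrable (fun s => ‖G y s‖ ^ 2) (Q i) ∧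
        ∫ s, ‖G y s‖ ^ 2 ∂(Q i) ≤ L ^ 2) →
      Integrable (fun ω => objective Q F (averageIterate x T ω)) μ ∧
      (∫ ω, objective Q F (averageIterate x T ω) ∂μ) - objective Q F xstar ≤
        5 * R * L / 2 * (Real.sqrt (tauMix P T) / Real.sqrt (T : ℝ))
          + 5 * R * L / Real.sqrt (T : ℝ)
          + R * L / (T : ℝ) * tauMix P T)
    ∧
    (∀ δ : ℝ, 0 < δ → δ < 1 → tauMix P T ≤ (T : ℝ) / 2 →
      (∀ i, ∀ y ∈ X, ∀ᵐ s ∂(Q i), ‖G y s‖ ≤ L) →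
      1 - δ ≤ μ.real {ω | objective Q F (averageIterate x T ω) - objective Q F xstar ≤
        5 * R * L / 2 * (Real.sqrt (tauMix P T) / Real.sqrt (T : ℝ))
          + 2 * R * L / Real.sqrt (T : ℝ)
          + R * L / (T : ℝ) * tauMix P T
          + 3 * R * L / Real.sqrt (T : ℝ)
            * Real.sqrt (tauMix P T * Real.log (tauMix P T / δ))}) := by
  have hx' : IsMirrorDescent X ψ G (stepSize R L (tauMix P T)) ξ x := hx
  refine ⟨fun hG => ?_, fun δ hδ hδ' hθT hG => ?_⟩
  · simpa only [mul_assoc] using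
      hx'.integral_objective_averageIterate_sub_le hψ hF hξ hP hσ hn hR hL hG hxstar hT
  · refine (hx'.measureReal_objective_averageIterate_sub_le hψ hF hξ hP hσ hn hR hL hG hxstar hT
      hδ hδ'.le hθT).trans_eq ?_
    congr! 4
    ring

theorem corollary3
    {E : Type*} [NormedAddCommGroup E] [NormedSpace ℝ E] [FiniteDimensional ℝ E]
    [MeasurableSpace E] [BorelSpace E]
    {Ξ : Type*} [MeasurableSpace Ξ]
    {Ω : Type*} [MeasurableSpace Ω] (μ : Measure Ω) [IsProbabilityMeasure μ]
    (X : Set E) (ψ : E → ℝ) (R L : ℝ) (hR : 0 < R) (hL : 0 < L) (hψ : IsProxSetup X ψ R)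
    (n : ℕ) (hn : 2 ≤ n)
    (P : Matrix (Fin n) (Fin n) ℝ) (hP : P ∈ doublyStochastic ℝ (Fin n))
    (hσ : secondSingularValue P < 1)
    (Q : Fin n → Measure Ξ) [∀ i, IsProbabilityMeasure (Q i)]
    (F : E → Ξ → ℝ) (G : E → Ξ → StrongDual ℝ E) (hF : IsLossFamily X Q F G)
    (token : ℕ → Ω → Fin n) (ξ : ℕ → Ω → Ξ) (hξ : IsTokenSampling μ P Q token ξ)
    (T : ℕ) (hT : 1 ≤ T)
    (x : ℕ → Ω → E)
    (hx : IsMirrorDescent X ψ G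
      (fun t => (R / (L * Real.sqrt (tauMix P T))) / Real.sqrt (t : ℝ)) ξ x)
    (xstar : E) (hxstar : xstar ∈ X) :
    ((∀ i, ∀ y ∈ X, Integrable (fun s => ‖G y s‖ ^ 2) (Q i) ∧
        ∫ s, ‖G y s‖ ^ 2 ∂(Q i) ≤ L ^ 2) →
      Integrable (fun ω => objective Q F (averageIterate x T ω)) μ ∧
      (∫ ω, objective Q F (averageIterate x T ω) ∂μ) - objective Q F xstar ≤
        5 * R * L / 2 * (Real.sqrt (tauMix P T) / Real.sqrt (T : ℝ))
          + 5 * R * L / Real.sqrt (T : ℝ)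
          + R * L / (T : ℝ) * tauMix P T)
    ∧
    (∀ δ : ℝ, 0 < δ → δ < 1 → tauMix P T ≤ (T : ℝ) / 2 →
      (∀ i, ∀ y ∈ X, ∀ᵐ s ∂(Q i), ‖G y s‖ ≤ L) →
      1 - δ ≤ μ.real {ω | objective Q F (averageIterate x T ω) - objective Q F xstar ≤
        5 * R * L / 2 * (Real.sqrt (tauMix P T) / Real.sqrt (T : ℝ))
          + 2 * R * L / Real.sqrt (T : ℝ)
          + R * L / (T : ℝ) * tauMix P T
          + 3 * R * L / Real.sqrt (T : ℝ)
            * Real.sqrt (tauMix P T * Real.log (tauMix P T / δ))}) :=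
  corollary3_general μ X ψ R L hR hL hψ n hn P hP hσ Q F G hF token ξ hξ T hT x hx xstar hxstar
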